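/- Let $d\ge 1$, let $\mathbb R_+^*=(0,\infty)$, and let $G=\mathbb R^d\rtimes\mathbb R_+^*$ act on $\mathbb R^d$ by $(b,a)\cdot x=ax+b$. For a measure $m$ on $G$ and a measure $\rho$ on $\mathbb R^d$ (or on $\mathbb R^d\setminus\{0\}$, when $m=\delta_{(0,a)}$) put $(m*_G\rho)(f)=\int_G\int f(ax+b)\,\rho(dx)\,m(db\,da)$; thus $\delta_{(0,a)}*_G\rho$ is the image of $\rho$ under $x\mapsto ax$. Let $\mu$ be a probability measure on $G$ and let $(B,A)$ be a random variable with law $\mu$. Assume hypothesis (H): $\mathbb P[A=1]<1$; $\mathbb P[Ax+B=x]<1$ for every $x\in\mathbb R^d$; $\mathbb E\big[(|\log A|+\log^+|B|)^{2+\varepsilon}\big]<\infty$ for some $\varepsilon>0$; and $\mathbb E[\log A]=0$. Let $\mu_A$ be the law of $A$ and let $G(\mu_A)$ be the closed subgroup of $\mathbb R_+^*$ generated by the support of $\mu_A$. Let $\nu$ be a nonzero $\mu$-invariant Radon measure on $\mathbb R^d$, that is, $\mu*_G\nu=\nu$. Then there is a positive measurable slowly varying function $L$ on $\mathbb R_+^*$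 (that is, $\lim_{z\to+\infty}L(az)/L(z)=1$ for every $a>0$) with the following properties. 1. The family of measures $\dfrac{\delta_{(0,z^{-1})}*_G\nu}{L(z)}$, $z\ge 1$, is weakly relatively compact on $\mathbb R^d\setminus\{0\}$: for every bounded measurable function $\phi$ with compact support in $\mathbb R^d\setminus\{0\}$ the quantity $\dfrac{(\delta_{(0,z^{-1})}*_G\nu)(\phi)}{L(z)}$ is bounded in $z\ge1$, and for every sequence $z_n\ge 1$ there are a subsequence $(z_{n_k})$ and a Radon measure $\eta$ on $\mathbb R^d\setminus\{0\}$ such that $\dfrac{(\delta_{(0,z_{n_k}^{-1})}*_G\nu)(\phi)}{L(z_{n_k})}\to\eta(\phi)$ for all $\phi\in C_c(\mathbb R^d\setminus\{0\})$. 2. Every accumulation point $\eta$ of this family as $z\to+\infty$, that is, every Radon measure $\eta$ on $\mathbb R^d\setminus\{0\}$ for which there is a sequence $z_n\to+\infty$ with $\dfrac{(\delta_{(0,z_n^{-1})}*_G\nu)(\phi)}{L(z_n)}\to\eta(\phi)$ for all $\phi\in C_c(\mathbb R^d\setminus\{0\})$, is nonzero and satisfies $\delta_{(0,a)}*_G\eta=\eta$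 for all $a\in G(\mu_A)$. Moreover, $(1+|x|)^{-\gamma}\in L^1(\nu)$ for every $\gamma>0$. -/

import Mathlib

open MeasureTheory Filter Topology

noncomputable section

namespace RandomDifference

/-- The multiplicative group of positive reals, as a subtype of `ℝ` (its group structure, order,
topology and Borel sigma-algebra are Mathlib's). -/
abbrev PosReal : Type := {a : ℝ // 0 < a}

/-- Euclidean space of dimension `d`. -/
abbrev Euc (d : ℕ) : Type := EuclideanSpace ℝ (Fin d)

/-- The underlying measurable space of the `ax+b` group; its elements are the pairs `(b, a)`. -/
abbrev AffGroup (d : ℕ) : Type := Euc d × PosReal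

/-- The action `(b, a) · x = a x + b`. -/
def affAct {d : ℕ} (g : AffGroup d) (x : Euc d) : Euc d := (g.2 : ℝ) • x + g.1

/-- The convolution `m *_G ρ`, i.e. the image of `m ⊗ ρ` under the action map, so that
`(m *_G ρ)(f) = ∫∫ f (a x + b) ρ(dx) m(db da)`. -/
def affConv {d : ℕ} (m : Measure (AffGroup d)) (ρ : Measure (Euc d)) : Measure (Euc d) :=
  (m.prod ρ).map (fun p => affAct p.1 p.2)

/-- The measure `δ_{(0,a)} *_G ρ`. -/
def dilate {d : ℕ} (a : PosReal) (ρ : Measure (Euc d)) : Measure (Euc d) :=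
  affConv (Measure.dirac ((0 : Euc d), a)) ρ

theorem measurable_affAct {d : ℕ} :
    Measurable (fun p : AffGroup d × Euc d => affAct p.1 p.2) := by
  unfold affAct
  fun_prop

theorem lintegral_affConv {d : ℕ} (m : Measure (AffGroup d)) (ρ : Measure (Euc d)) [SFinite ρ]
    {f : Euc d → ENNReal} (hf : Measurable f) :
    ∫⁻ y, f y ∂(affConv m ρ) = ∫⁻ g, ∫⁻ x, f (affAct g x) ∂ρ ∂m := by
  rw [affConv, lintegral_map hf measurable_affAct]
  exact lintegral_prod _ (hf.comp measurable_affAct).aemeasurable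

theorem dilate_eq_map {d : ℕ} (a : PosReal) (ρ : Measure (Euc d)) [SFinite ρ] :
    dilate a ρ = ρ.map (fun x => (a : ℝ) • x) := by
  rw [dilate, affConv, Measure.dirac_prod, Measure.map_map measurable_affAct (by fun_prop)]
  congr 1
  funext x
  simp [affAct]

/-- Hypothesis (H) on the law `μ` of `(B, A)`. -/
structure HypothesisH {d : ℕ} (μ : Measure (AffGroup d)) : Prop where
  /-- `P[A = 1] < 1` -/
  scale_nontrivial : μ {g | g.2 = 1} < 1
  /-- `P[A x + B = x] < 1` for every `x` -/
  no_fixed_point : ∀ x : Euc d, μ {g | affAct g x = x} < 1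
  /-- `E (|log A| + log⁺ |B|)^(2+ε) < ∞` for some `ε > 0` -/
  moment : ∃ ε : ℝ, 0 < ε ∧
    ∫⁻ g, ENNReal.ofReal ((|Real.log (g.2 : ℝ)| + Real.posLog ‖g.1‖) ^ (2 + ε)) ∂μ < ⊤
  /-- `E log A = 0` (the integrability of `log A` is contained in `moment`) -/
  centered : ∫ g, Real.log (g.2 : ℝ) ∂μ = 0

/-- The law `μ_A` of `A`. -/
def scaleLaw {d : ℕ} (μ : Measure (AffGroup d)) : Measure PosReal := μ.map Prod.snd

/-- `G(μ_A)`: the closed subgroup of the positive reals generated by the support of `μ_A`, i.e. the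
smallest closed subgroup containing this support. -/
def scaleGroup {d : ℕ} (μ : Measure (AffGroup d)) : Subgroup PosReal :=
  sInf {H : Subgroup PosReal | IsClosed (H : Set PosReal) ∧ (scaleLaw μ).support ⊆ H}

/-- Positive (measurable) slowly varying functions on the positive half line. -/
structure IsSlowlyVarying (L : PosReal → ℝ) : Prop where
  pos : ∀ z, 0 < L z
  measurable : Measurable L
  tendsto : ∀ a : PosReal, Tendsto (fun z : PosReal => L (a * z) / L z) atTop (𝓝 1)

/-- The functions with compact support contained in the punctured space `ℝ^d \ {0}`. They are
identified with their extensions by `0` to `ℝ^d`. -/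
def HasPuncturedCompactSupport {d : ℕ} (φ : Euc d → ℝ) : Prop :=
  HasCompactSupport φ ∧ (0 : Euc d) ∉ tsupport φ

/-- Radon measures on the punctured space `ℝ^d \ {0}`, identified with the Borel measures on
`ℝ^d` which give no mass to `0` and are finite on the compact subsets of `ℝ^d \ {0}`. -/
structure IsPuncturedRadon {d : ℕ} (η : Measure (Euc d)) : Prop where
  zero_mass : η {0} = 0
  finite_compact : ∀ K : Set (Euc d), IsCompact K → (0 : Euc d) ∉ K → η K < ⊤

/-- The normalized value `(δ_{(0,z⁻¹)} *_G ν)(φ) / L(z)`. -/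
def normValue {d : ℕ} (ν : Measure (Euc d)) (L : PosReal → ℝ) (z : PosReal) (φ : Euc d → ℝ) : ℝ :=
  (∫ x, φ x ∂(dilate z⁻¹ ν)) / L z

/-- Weak convergence on `ℝ^d \ {0}` (tested on `C_c(ℝ^d \ {0})`) of the normalized measures
`δ_{(0,z⁻¹)} *_G ν / L(z)` to `η` along the sequence `z = zs 0, zs 1, …`. -/
def NormTendsto {d : ℕ} (ν : Measure (Euc d)) (L : PosReal → ℝ) (zs : ℕ → PosReal)
    (η : Measure (Euc d)) : Prop :=
  ∀ φ : Euc d → ℝ, Continuous φ → HasPuncturedCompactSupport φ →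
    Tendsto (fun n => normValue ν L (zs n) φ) atTop (𝓝 (∫ x, φ x ∂η))

/-- `η` is an accumulation point, as `z → +∞`, of the normalized measures. -/
def IsAccumulationMeasure {d : ℕ} (ν : Measure (Euc d)) (L : PosReal → ℝ)
    (η : Measure (Euc d)) : Prop :=
  IsPuncturedRadon η ∧
    ∃ zs : ℕ → PosReal, Tendsto zs atTop atTop ∧ NormTendsto ν L zs η

end RandomDifference

end

/-!
The proof rests on a Harnack inequality at infinity and on a Liouville property.

Since `log A` is centered and not constant, with positive probability the random map expands, and
with positive probability it contracts, all large vectors by a factor bounded away from `1` and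
from infinity. Invariance gives `μ U * ν T ≤ ν S` as soon as every map in `U` sends `T` into `S`, so
enlarging a wide annulus by a fixed factor, outwards or inwards, multiplies its `ν`-mass by a
bounded factor (`exists_widening_bound`, `exists_harnack`). The masses of all annuli dilated by `z` are thus
dominated by that of one reference annulus. That mass is never zero at large scales: otherwise the
support of `ν` would be bounded and stable under an expanding map, hence a point fixed by almost
every map (`measure_norm_ge_ne_zero`). The normalizer `L(z)` is the mass of a cutoff of the
reference annulus at scale `z`, averaged over one logarithmic period `[0, ℓ]`, with `exp ℓ` in
`G(μ_A)`. Vague compactness of the normalized measures follows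
(`DominatesAnnuli.exists_subseq`).

If `η` is a vague limit along scales tending to infinity, the translation parts `B / z` vanish in
the limit, and Fatou's lemma turns `μ *_G ν = ν` into an inequality: for a test function `φ ≥ 0`
the function `f(s) = ∫ φ (exp s • x) η(dx)` satisfies `𝔼 f(s + log A) ≤ f(s)`. A nonnegative
continuous superharmonic function of a centered walk with finite variance is invariant under the
steps of the walk (`ae_eq_of_superharmonic`): for a bounded one, the defect `f - 𝔼 f(· + log A)`
integrated against the Cauchy kernel `τ / (τ + s²)` is at most `O(∫ (τ + s²)⁻¹ ds)`, by the second
order expansion of the kernel, and this tends to zero as `τ → ∞`; truncation reduces the general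
case to this one. Hence `η` is invariant under the support of `μ_A`, and so under `G(μ_A)`.

Finally, for such an `η` the windowed average is independent of the phase of the window, and by
normalization it equals `1`. So `η` is nonzero, and every subsequential limit of `L(az) / L(z)` is
`1`. Integrability of `(1 + ‖x‖)^(-γ)` follows by summing over the annuli between consecutive powers
of `exp 1`, whose masses are `O(L(exp n))`, with the ratio test.
-/

open MeasureTheory Filter Topology

noncomputable section

namespace RandomDifference

/-! ### Vague compactness -/

/-- A continuous function on a second countable locally compact space is uniformly approximated,
on a given compact set, by the members of a fixed countable family. -/
theorem exists_denseSeq_near {X : Type*} [TopologicalSpace X] [LocallyCompactSpace X]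
    [SecondCountableTopology X] (φ : C(X, ℝ)) {K : Set X} (hK : IsCompact K) {ε : ℝ} (hε : 0 < ε) :
    ∃ j, ∀ x ∈ K, |TopologicalSpace.denseSeq C(X, ℝ) j x - φ x| < ε := by
  have hmem : φ ∈ closure (Set.range (TopologicalSpace.denseSeq C(X, ℝ))) :=
    TopologicalSpace.denseRange_denseSeq C(X, ℝ) φ
  obtain ⟨u, hu, hlim⟩ := mem_closure_iff_seq_limit.1 hmem
  have h := ContinuousMap.tendsto_iff_forall_isCompact_tendstoUniformlyOn.1 hlim K hK
  obtain ⟨n, hn⟩ := (Metric.tendstoUniformlyOn_iff.1 h ε hε).exists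
  obtain ⟨j, hj⟩ := hu n
  refine ⟨j, fun x hx => ?_⟩
  rw [hj, ← Real.dist_eq, dist_comm]
  exact hn x hx

open scoped CompactlySupported in
/-- **Vague compactness.** A sequence of measures that is bounded on every compact set has a
subsequence which converges, against continuous compactly supported functions, to a measure that is
finite on compact sets. -/
theorem exists_vague_subseq {X : Type*} [TopologicalSpace X] [T2Space X] [LocallyCompactSpace X]
    [SecondCountableTopology X] [MeasurableSpace X] [BorelSpace X] (M : ℕ → Measure X)
    (hM : ∀ K : Set X, IsCompact K → ∃ C : ℝ, ∀ n, M n K ≤ ENNReal.ofReal C) :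
    ∃ (k : ℕ → ℕ) (η : Measure X), StrictMono k ∧ IsFiniteMeasureOnCompacts η ∧
      ∀ f : C_c(X, ℝ), Tendsto (fun n => ∫ x, f x ∂(M (k n))) atTop (𝓝 (∫ x, f x ∂η)) := by
  have hfin : ∀ n, IsFiniteMeasureOnCompacts (M n) := fun n => ⟨fun K hK => by
    obtain ⟨C, hC⟩ := hM K hK
    exact (hC n).trans_lt ENNReal.ofReal_lt_top⟩
  have hint : ∀ (f : C_c(X, ℝ)) n, Integrable f (M n) := fun f n =>
    f.continuous.integrable_of_hasCompactSupport f.hasCompactSupport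
  -- a bound of the integral by the sup norm on a compact set carrying the function
  have hbound : ∀ K : Set X, IsCompact K → ∃ C : ℝ, 0 ≤ C ∧ ∀ (f : X → ℝ) (ε : ℝ), 0 ≤ ε →
      (∀ x, |f x| ≤ ε) → (∀ x, x ∉ K → f x = 0) → ∀ n, |∫ x, f x ∂(M n)| ≤ ε * C := by
    intro K hK
    obtain ⟨C, hC⟩ := hM K hK
    refine ⟨max C 0, le_max_right _ _, fun f ε hε hf hfK n => ?_⟩
    have h1 : ∫ x, f x ∂(M n) = ∫ x in K, f x ∂(M n) :=
      (setIntegral_eq_integral_of_forall_compl_eq_zero hfK).symm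
    rw [h1, ← Real.norm_eq_abs]
    refine (norm_setIntegral_le_of_norm_le_const hK.measure_lt_top (fun x _ => hf x)).trans ?_
    refine mul_le_mul_of_nonneg_left ?_ hε
    refine ENNReal.toReal_le_of_le_ofReal (le_max_right _ _) ((hC n).trans ?_)
    exact ENNReal.ofReal_le_ofReal (le_max_left _ _)
  let E : CompactExhaustion X := default
  have hχ : ∀ i, ∃ χ : C_c(X, ℝ), (∀ x ∈ E i, χ x = 1) ∧ ∀ x, χ x ∈ Set.Icc (0 : ℝ) 1 := by
    intro i
    obtain ⟨f, h1, -, hc, h01⟩ := exists_continuous_one_zero_of_isCompact (E.isCompact i)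
      isClosed_empty (Set.disjoint_empty _)
    exact ⟨⟨f, hc⟩, fun x hx => h1 hx, h01⟩
  choose χ hχ1 hχ01 using hχ
  -- the countable family: cutoffs of an exhaustion times a dense sequence
  let F : ℕ × ℕ → X → ℝ := fun p x => χ p.1 x * TopologicalSpace.denseSeq C(X, ℝ) p.2 x
  have hFbd : ∀ p, ∃ B : ℝ, ∀ n, ∫ x, F p x ∂(M n) ∈ Set.Icc (-B) B := by
    intro p
    have hc : HasCompactSupport (F p) := (χ p.1).hasCompactSupport.mul_right
    have hcont : Continuous (F p) := (χ p.1).continuous.mul (ContinuousMap.continuous _)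
    obtain ⟨B, hB⟩ := hcont.bounded_above_of_compact_support hc
    obtain ⟨C, hC0, hC⟩ := hbound _ hc
    refine ⟨max B 0 * C, fun n => abs_le.1 (hC _ _ (le_max_right _ _) (fun x => ?_)
      (fun x hx => image_eq_zero_of_notMem_tsupport hx) n)⟩
    exact (hB x).trans (le_max_left _ _)
  choose B hB using hFbd
  obtain ⟨a, -, k, hk, hlim⟩ := (isCompact_univ_pi (fun p => isCompact_Icc
    (a := -B p) (b := B p))).tendsto_subseq (x := fun n p => ∫ x, F p x ∂(M n))
    (fun n p _ => hB p n)
  rw [tendsto_pi_nhds] at hlim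
  -- along `k` the integrals of the countable family converge; by approximation so do all others
  have hconv : ∀ f : C_c(X, ℝ), ∃ l, Tendsto (fun n => ∫ x, f x ∂(M (k n))) atTop (𝓝 l) := by
    intro f
    obtain ⟨i, hi⟩ := E.exists_superset_of_isCompact f.hasCompactSupport
    obtain ⟨C, hC0, hC⟩ := hbound _ (χ i).hasCompactSupport
    refine cauchySeq_tendsto_of_complete (Metric.cauchySeq_iff'.2 fun ε hε => ?_)
    set δ := ε / (3 * (C + 1)) with hδ
    have hδ0 : 0 < δ := by positivity
    obtain ⟨j, hj⟩ := exists_denseSeq_near (f : C(X, ℝ)) (χ i).hasCompactSupport hδ0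
    have hFint : ∀ n, Integrable (F (i, j)) (M n) := fun n =>
      Continuous.integrable_of_hasCompactSupport
        ((χ i).continuous.mul (ContinuousMap.continuous _)) (χ i).hasCompactSupport.mul_right
    have hclose : ∀ n, |∫ x, f x ∂(M n) - ∫ x, F (i, j) x ∂(M n)| < ε / 3 := by
      intro n
      rw [← integral_sub (hint f n) (hFint n)]
      have h := hC (fun x => f x - F (i, j) x) δ hδ0.le (fun x => ?_) (fun x hx => ?_) n
      · refine h.trans_lt ?_
        rw [hδ, div_mul_eq_mul_div, div_lt_div_iff₀ (by positivity) (by positivity)]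
        nlinarith
      · by_cases hx : x ∈ tsupport (χ i)
        · have hf1 : f x = χ i x * f x := by
            by_cases hfx : x ∈ tsupport f
            · rw [hχ1 i x (hi hfx), one_mul]
            · rw [image_eq_zero_of_notMem_tsupport hfx, mul_zero]
          have : f x - F (i, j) x
              = χ i x * -(TopologicalSpace.denseSeq C(X, ℝ) j x - f x) := by
            simp only [F]; linear_combination hf1
          rw [this, abs_mul, abs_neg, abs_of_nonneg (hχ01 i x).1]
          have := (hj x hx).le
          calc χ i x * _ ≤ 1 * δ := mul_le_mul (hχ01 i x).2 this (abs_nonneg _) zero_le_one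
            _ = δ := one_mul _
        · have h0 : χ i x = 0 := image_eq_zero_of_notMem_tsupport hx
          have : f x = 0 := by
            by_contra hne
            have := hχ1 i x (hi (subset_tsupport _ hne))
            rw [h0] at this; exact zero_ne_one this
          simp [F, h0, this, hδ0.le]
      · have h0 : χ i x = 0 := image_eq_zero_of_notMem_tsupport hx
        have : f x = 0 := by
          by_contra hne
          have := hχ1 i x (hi (subset_tsupport _ hne))
          rw [h0] at this; exact zero_ne_one this
        simp [F, h0, this]
    obtain ⟨N, hN⟩ := Metric.cauchySeq_iff'.1 (hlim (i, j)).cauchySeq (ε / 3) (by positivity)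
    refine ⟨N, fun n hn => ?_⟩
    have h1 := abs_lt.1 (hclose (k n))
    have h2 := abs_lt.1 (hclose (k N))
    have h3 := hN n hn
    rw [Real.dist_eq] at h3 ⊢
    have h3 := abs_lt.1 h3
    simp only [Function.comp_apply] at h3
    rw [abs_lt]
    constructor <;> linarith [h1.1, h1.2, h2.1, h2.2, h3.1, h3.2]
  choose l hl using hconv
  let Λ : C_c(X, ℝ) →ₚ[ℝ] ℝ := PositiveLinearMap.mk₀
    { toFun := l
      map_add' := fun f g => tendsto_nhds_unique (hl (f + g)) (by
        have := (hl f).add (hl g)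
        refine this.congr fun n => ?_
        rw [← integral_add (hint f _) (hint g _)]
        rfl)
      map_smul' := fun c f => tendsto_nhds_unique (hl (c • f)) (by
        have := (hl f).const_mul c
        refine this.congr fun n => ?_
        rw [← integral_const_mul]
        rfl) }
    (fun f hf => ge_of_tendsto' (hl f) fun n => integral_nonneg fun x => hf x)
  refine ⟨k, RealRMK.rieszMeasure Λ, hk, inferInstance, fun f => ?_⟩
  rw [RealRMK.integral_rieszMeasure]
  exact hl f

/-! ### Annuli and the punctured space -/

section Annuli

variable {d : ℕ}

/-- The closed annulus `{x | r ≤ ‖x‖ ≤ t}`. -/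
def annulus (d : ℕ) (r t : ℝ) : Set (Euc d) := {x | r ≤ ‖x‖ ∧ ‖x‖ ≤ t}

theorem isClosed_annulus (r t : ℝ) : IsClosed (annulus d r t) :=
  (isClosed_le continuous_const continuous_norm).inter
    (isClosed_le continuous_norm continuous_const)

theorem measurableSet_annulus (r t : ℝ) : MeasurableSet (annulus d r t) :=
  (isClosed_annulus r t).measurableSet

theorem isCompact_annulus (r t : ℝ) : IsCompact (annulus d r t) :=
  (isCompact_closedBall (0 : Euc d) t).of_isClosed_subset (isClosed_annulus r t)
    fun x hx => by simpa using hx.2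

theorem annulus_subset {r t r' t' : ℝ} (hr : r' ≤ r) (ht : t ≤ t') :
    annulus d r t ⊆ annulus d r' t' := fun _ hx => ⟨hr.trans hx.1, hx.2.trans ht⟩

theorem zero_notMem_annulus {r t : ℝ} (hr : 0 < r) : (0 : Euc d) ∉ annulus d r t := fun h => by
  have := h.1
  rw [norm_zero] at this
  linarith

theorem exists_annulus_of_isCompact {K : Set (Euc d)} (hK : IsCompact K) (h0 : (0 : Euc d) ∉ K) :
    ∃ α β : ℝ, 0 < α ∧ α ≤ β ∧ K ⊆ annulus d α β := by
  obtain ⟨α, hα, hball⟩ := Metric.isOpen_iff.1 hK.isClosed.isOpen_compl 0 h0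
  obtain ⟨β, hβ⟩ := hK.isBounded.exists_norm_le
  refine ⟨α, max α β, hα, le_max_left _ _, fun x hx => ⟨?_, (hβ x hx).trans (le_max_right _ _)⟩⟩
  by_contra h
  exact hball (by simpa using h) hx

theorem HasPuncturedCompactSupport.exists_annulus {φ : Euc d → ℝ}
    (h : HasPuncturedCompactSupport φ) :
    ∃ α β : ℝ, 0 < α ∧ α ≤ β ∧ ∀ x, x ∉ annulus d α β → φ x = 0 := by
  obtain ⟨α, β, hα, hβ, hs⟩ := exists_annulus_of_isCompact h.1 h.2
  exact ⟨α, β, hα, hβ, fun x hx => image_eq_zero_of_notMem_tsupport fun h => hx (hs h)⟩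

theorem hasPuncturedCompactSupport_of_annulus {φ : Euc d → ℝ} {α β : ℝ} (hα : 0 < α)
    (h : ∀ x, x ∉ annulus d α β → φ x = 0) : HasPuncturedCompactSupport φ := by
  have hs : tsupport φ ⊆ annulus d α β :=
    closure_minimal (fun x hx => by_contra fun hn => hx (h x hn)) (isClosed_annulus α β)
  exact ⟨(isCompact_annulus α β).of_isClosed_subset (isClosed_tsupport φ) hs,
    fun h0 => zero_notMem_annulus hα (hs h0)⟩

/-- A continuous cutoff function for an annulus. -/
theorem exists_cutoff {α β : ℝ} (hα : 0 < α) (hβ : 0 < β) :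
    ∃ χ : Euc d → ℝ, Continuous χ ∧ (∀ x, 0 ≤ χ x) ∧ (∀ x, χ x ≤ 1) ∧
      (∀ x ∈ annulus d α β, χ x = 1) ∧ ∀ x, x ∉ annulus d (α / 2) (2 * β) → χ x = 0 := by
  have hcl : IsClosed ({x : Euc d | ‖x‖ ≤ α / 2} ∪ {x : Euc d | 2 * β ≤ ‖x‖}) :=
    (isClosed_le continuous_norm continuous_const).union
      (isClosed_le continuous_const continuous_norm)
  obtain ⟨f, h0, h1, h01⟩ := exists_continuous_zero_one_of_isClosed hcl
    (isClosed_annulus (d := d) α β) (by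
      rw [Set.disjoint_left]
      rintro x (hx | hx) ⟨h1, h2⟩
      · have : ‖x‖ ≤ α / 2 := hx
        linarith
      · have : 2 * β ≤ ‖x‖ := hx
        linarith)
  refine ⟨f, f.continuous, fun x => (h01 x).1, fun x => (h01 x).2, fun x hx => h1 hx,
    fun x hx => h0 ?_⟩
  by_contra hn
  simp only [Set.mem_union, Set.mem_ofPred_eq, not_or, not_le] at hn
  exact hx ⟨hn.1.le, hn.2.le⟩

theorem integrable_of_annulus {η : Measure (Euc d)} {φ : Euc d → ℝ} (hφ : Continuous φ) {α β : ℝ}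
    (h : ∀ x, x ∉ annulus d α β → φ x = 0) (hη : η (annulus d α β) < ⊤) : Integrable φ η := by
  obtain ⟨C, hC⟩ := (isCompact_annulus (d := d) α β).exists_bound_of_continuousOn hφ.continuousOn
  have h1 : IntegrableOn φ (annulus d α β) η :=
    Measure.integrableOn_of_bounded hη.ne hφ.aestronglyMeasurable
      (ae_restrict_of_forall_mem (measurableSet_annulus α β) hC)
  exact h1.integrable_of_forall_notMem_eq_zero h

/-- A function bounded by `M` and supported in an annulus has integral at most `M` times the mass
of the annulus. -/
theorem abs_integral_le_of_annulus {η : Measure (Euc d)} {φ : Euc d → ℝ} {α β M C : ℝ}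
    (hM : ∀ x, |φ x| ≤ M) (h : ∀ x, x ∉ annulus d α β → φ x = 0) (hC0 : 0 ≤ C)
    (hη : η (annulus d α β) ≤ ENNReal.ofReal C) : |∫ x, φ x ∂η| ≤ M * C := by
  rw [← setIntegral_eq_integral_of_forall_compl_eq_zero h, ← Real.norm_eq_abs]
  refine (norm_setIntegral_le_of_norm_le_const (hη.trans_lt ENNReal.ofReal_lt_top)
    (fun x _ => hM x)).trans ?_
  exact mul_le_mul_of_nonneg_left (ENNReal.toReal_le_of_le_ofReal hC0 hη)
    ((abs_nonneg _).trans (hM 0))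

/-- The annuli `(n+1)⁻¹ ≤ ‖x‖ ≤ n+1` exhaust the punctured space. -/
theorem exists_mem_annulus {x : Euc d} (hx : x ≠ 0) :
    ∃ n : ℕ, x ∈ annulus d ((n : ℝ) + 1)⁻¹ (n + 1) := by
  have hpos : 0 < ‖x‖ := norm_pos_iff.2 hx
  obtain ⟨n, hn⟩ := exists_nat_ge (max ‖x‖ ‖x‖⁻¹)
  refine ⟨n, ?_, ?_⟩
  · rw [inv_le_comm₀ (by positivity) hpos]
    linarith [le_max_right ‖x‖ ‖x‖⁻¹]
  · linarith [le_max_left ‖x‖ ‖x‖⁻¹]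

namespace IsPuncturedRadon

variable {η : Measure (Euc d)}

theorem annulus_lt_top (h : IsPuncturedRadon η) {α : ℝ} (hα : 0 < α) (β : ℝ) :
    η (annulus d α β) < ⊤ :=
  h.finite_compact _ (isCompact_annulus α β) (zero_notMem_annulus hα)

theorem integrable (h : IsPuncturedRadon η) {φ : Euc d → ℝ} (hφ : Continuous φ)
    (hs : HasPuncturedCompactSupport φ) : Integrable φ η := by
  obtain ⟨α, β, hα, -, h0⟩ := hs.exists_annulus
  exact integrable_of_annulus hφ h0 (h.annulus_lt_top hα β)

theorem sigmaFinite (h : IsPuncturedRadon η) : SigmaFinite η := by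
  refine ⟨⟨⟨fun n => annulus d ((n : ℝ) + 1)⁻¹ (n + 1) ∪ {0}, fun _ => trivial, fun n => ?_, ?_⟩⟩⟩
  · refine (measure_union_le _ _).trans_lt ?_
    rw [h.zero_mass, add_zero]
    exact h.annulus_lt_top (by positivity) _
  · refine Set.eq_univ_of_forall fun x => Set.mem_iUnion.2 ?_
    by_cases hx : x = 0
    · exact ⟨0, Or.inr hx⟩
    · obtain ⟨n, hn⟩ := exists_mem_annulus hx
      exact ⟨n, Or.inl hn⟩

/-- Radon measures on the punctured space are determined by their integrals of nonnegative
continuous functions with compact support in the punctured space. -/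
theorem ext_of_integral {η' : Measure (Euc d)} (h : IsPuncturedRadon η) (h' : IsPuncturedRadon η')
    (heq : ∀ φ : Euc d → ℝ, Continuous φ → HasPuncturedCompactSupport φ →
      (∀ x, 0 ≤ φ x) → ∫ x, φ x ∂η = ∫ x, φ x ∂η') : η = η' := by
  -- multiplied by a cutoff, both measures are finite and can be compared on bounded functions
  have hcut : ∀ n : ℕ, ∀ S ⊆ annulus d ((n : ℝ) + 1)⁻¹ (n + 1), MeasurableSet S → η S = η' S := by
    intro n S hS hSm
    have hn : (0 : ℝ) < (n : ℝ) + 1 := by positivity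
    obtain ⟨χ, hc, h0, h1, hone, hzero⟩ := exists_cutoff (d := d) (inv_pos.2 hn) hn
    have hχ : ∀ ρ : Measure (Euc d), IsPuncturedRadon ρ → IsFiniteMeasure
        (ρ.withDensity fun x => ENNReal.ofReal (χ x)) := fun ρ hρ => by
      refine isFiniteMeasure_withDensity_ofReal ?_
      exact (integrable_of_annulus hc hzero (hρ.annulus_lt_top (by positivity) _)).2
    have := hχ η h
    have := hχ η' h'
    have hm : Measurable fun x => ENNReal.ofReal (χ x) := hc.measurable.ennreal_ofReal
    have hden : ∀ ρ : Measure (Euc d), ∀ f : Euc d → NNReal,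
        ∫⁻ x, f x ∂(ρ.withDensity fun x => ENNReal.ofReal (χ x))
          = ∫⁻ x, ENNReal.ofReal (χ x * f x) ∂ρ := by
      intro ρ f
      rw [lintegral_withDensity_eq_lintegral_mul_non_measurable _ hm (by simp)]
      refine lintegral_congr fun x => ?_
      simp [ENNReal.ofReal_mul (h0 x)]
    have key : η.withDensity (fun x => ENNReal.ofReal (χ x))
        = η'.withDensity (fun x => ENNReal.ofReal (χ x)) := by
      refine ext_of_forall_lintegral_eq_of_IsFiniteMeasure fun f => ?_
      have hfc : Continuous fun x => χ x * (f x : ℝ) := by fun_prop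
      have hz : ∀ x, x ∉ annulus d (((n : ℝ) + 1)⁻¹ / 2) (2 * (n + 1)) → χ x * (f x : ℝ) = 0 :=
        fun x hx => by rw [hzero x hx, zero_mul]
      have hnn : ∀ x, 0 ≤ χ x * (f x : ℝ) := fun x => mul_nonneg (h0 x) (f x).2
      have hp := hasPuncturedCompactSupport_of_annulus (by positivity) hz
      rw [hden, hden, ← ofReal_integral_eq_lintegral_ofReal (h.integrable hfc hp)
        (Eventually.of_forall hnn), ← ofReal_integral_eq_lintegral_ofReal (h'.integrable hfc hp)
        (Eventually.of_forall hnn), heq _ hfc hp hnn]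
    have hS' : ∀ ρ : Measure (Euc d), ρ.withDensity (fun x => ENNReal.ofReal (χ x)) S = ρ S := by
      intro ρ
      rw [withDensity_apply _ hSm, setLIntegral_congr_fun (g := fun _ => 1) hSm
        (fun x hx => by simp [hone x (hS hx)])]
      simp
    rw [← hS' η, ← hS' η', key]
  ext S hS
  have hmono : Monotone fun n : ℕ => annulus d ((n : ℝ) + 1)⁻¹ (n + 1) := fun m n hmn => by
    have : (m : ℝ) ≤ n := Nat.cast_le.2 hmn
    exact annulus_subset (inv_anti₀ (by positivity) (by linarith)) (by linarith)
  have hS0 : ∀ ρ : Measure (Euc d), IsPuncturedRadon ρ →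
      ρ S = ⨆ n : ℕ, ρ (S ∩ annulus d ((n : ℝ) + 1)⁻¹ (n + 1)) := by
    intro ρ hρ
    rw [← Monotone.measure_iUnion fun m n hmn => Set.inter_subset_inter_right S (hmono hmn),
      ← Set.inter_iUnion]
    refine le_antisymm ?_ (measure_mono Set.inter_subset_left)
    refine (measure_mono (t := (S ∩ ⋃ n : ℕ, annulus d ((n : ℝ) + 1)⁻¹ (n + 1)) ∪ {0})
      fun x hx => ?_).trans ((measure_union_le _ _).trans (by rw [hρ.zero_mass, add_zero]))
    by_cases hx0 : x = 0
    · exact Or.inr hx0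
    · exact Or.inl ⟨hx, Set.mem_iUnion.2 (exists_mem_annulus hx0)⟩
  rw [hS0 η h, hS0 η' h']
  exact iSup_congr fun n => hcut n _ Set.inter_subset_right (hS.inter (measurableSet_annulus _ _))

end IsPuncturedRadon

open scoped CompactlySupported in
/-- Vague compactness on the punctured space. -/
theorem exists_punctured_subseq (M : ℕ → Measure (Euc d))
    (hM : ∀ α β : ℝ, 0 < α → ∃ C : ℝ, ∀ n, M n (annulus d α β) ≤ ENNReal.ofReal C) :
    ∃ (k : ℕ → ℕ) (η : Measure (Euc d)), StrictMono k ∧ IsPuncturedRadon η ∧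
      ∀ φ : Euc d → ℝ, Continuous φ → HasPuncturedCompactSupport φ →
        Tendsto (fun n => ∫ x, φ x ∂(M (k n))) atTop (𝓝 (∫ x, φ x ∂η)) := by
  let X : Set (Euc d) := {0}ᶜ
  have hX : MeasurableSet X := (measurableSet_singleton _).compl
  have hXo : IsOpen X := isOpen_compl_singleton
  have : LocallyCompactSpace X := hXo.locallyCompactSpace
  obtain ⟨k, η, hk, hη, hlim⟩ := exists_vague_subseq
    (fun n => (M n).comap ((↑) : X → Euc d)) (fun K hK => by
      have hK' : IsCompact (((↑) : X → Euc d) '' K) := hK.image continuous_subtype_val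
      obtain ⟨α, β, hα, -, hs⟩ := exists_annulus_of_isCompact hK' (by
        rintro ⟨x, -, hx⟩
        exact x.2 hx)
      obtain ⟨C, hC⟩ := hM α β hα
      refine ⟨C, fun n => ?_⟩
      rw [comap_subtype_coe_apply hX]
      exact (measure_mono hs).trans (hC n))
  refine ⟨k, η.map (↑), hk, ⟨?_, fun K hK h0 => ?_⟩, fun φ hφ hs => ?_⟩
  · rw [Measure.map_apply measurable_subtype_coe (measurableSet_singleton _)]
    convert measure_empty (μ := η)
    exact Set.eq_empty_of_forall_notMem fun x => x.2
  · rw [Measure.map_apply measurable_subtype_coe hK.measurableSet]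
    refine IsCompact.measure_lt_top (Topology.IsInducing.subtypeVal.isCompact_preimage' hK ?_)
    rw [Subtype.range_coe]
    exact fun x hx hx0 => h0 (hx0 ▸ hx)
  · have hcs : HasCompactSupport fun x : X => φ x := by
      refine HasCompactSupport.of_support_subset_isCompact
        (K := ((↑) : X → Euc d) ⁻¹' tsupport φ)
        (Topology.IsInducing.subtypeVal.isCompact_preimage' hs.1 ?_)
        (fun x hx => subset_tsupport φ hx)
      rw [Subtype.range_coe]
      exact fun x hx hx0 => hs.2 (hx0 ▸ hx)
    have h := hlim ⟨⟨fun x : X => φ x, hφ.comp continuous_subtype_val⟩, hcs⟩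
    rw [integral_map measurable_subtype_coe.aemeasurable hφ.aestronglyMeasurable]
    refine h.congr fun n => ?_
    change ∫ x : X, φ x ∂_ = _
    rw [integral_subtype_comap hX]
    refine setIntegral_eq_integral_of_forall_compl_eq_zero fun x hx => ?_
    have : x = 0 := by simpa [X] using hx
    rw [this]
    exact image_eq_zero_of_notMem_tsupport hs.2

end Annuli

/-! ### Superharmonic functions of a centered random walk -/

/-- Second order expansion of the Cauchy kernel `1 / (τ + s²)`, with a remainder that is small
relative to the kernel itself, uniformly in the increment `x`. -/
theorem abs_cauchyKernel_expansion_le {τ : ℝ} (hτ : 0 < τ) (s x : ℝ) :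
    |(τ + s ^ 2)⁻¹ - (τ + (s - x) ^ 2)⁻¹ - x * (-2 * s / (τ + s ^ 2) ^ 2)|
      ≤ 2 * x ^ 2 / τ * (τ + s ^ 2)⁻¹ := by
  have hp : 0 < τ + s ^ 2 := by positivity
  have hq : 0 < τ + (s - x) ^ 2 := by positivity
  have h1 : (τ + s ^ 2)⁻¹ - (τ + (s - x) ^ 2)⁻¹ - x * (-2 * s / (τ + s ^ 2) ^ 2)
      = x ^ 2 * (τ - s ^ 2 - 2 * s * (s - x)) / ((τ + s ^ 2) ^ 2 * (τ + (s - x) ^ 2)) := by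
    field_simp
    ring
  have h2 : τ * |τ - s ^ 2 - 2 * s * (s - x)| ≤ 2 * ((τ + s ^ 2) * (τ + (s - x) ^ 2)) := by
    generalize s - x = y
    rw [← abs_of_pos hτ, ← abs_mul, abs_of_pos hτ, abs_le]
    have e1 := mul_nonneg hτ.le (sq_nonneg (s + y))
    have e2 := mul_nonneg hτ.le (sq_nonneg (s - y))
    have e3 := mul_nonneg hτ.le (sq_nonneg s)
    have e4 := mul_nonneg hτ.le (sq_nonneg y)
    have e5 := sq_nonneg (s * y)
    have e6 := sq_nonneg τ
    constructor <;> nlinarith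
  rw [h1, abs_div, abs_mul, abs_of_nonneg (sq_nonneg x),
    abs_of_pos (mul_pos (pow_pos hp 2) hq), div_le_iff₀ (by positivity)]
  have h3 : 2 * x ^ 2 / τ * (τ + s ^ 2)⁻¹ * ((τ + s ^ 2) ^ 2 * (τ + (s - x) ^ 2))
      = x ^ 2 * (2 * ((τ + s ^ 2) * (τ + (s - x) ^ 2)) / τ) := by
    field_simp
  rw [h3]
  refine mul_le_mul_of_nonneg_left ?_ (sq_nonneg x)
  rw [le_div_iff₀ hτ, mul_comm]
  exact h2

theorem inv_add_sq_le {τ : ℝ} (hτ : 1 ≤ τ) (s : ℝ) : (τ + s ^ 2)⁻¹ ≤ (1 + s ^ 2)⁻¹ :=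
  inv_anti₀ (by positivity) (by linarith)

theorem integrable_cauchyKernel {τ : ℝ} (hτ : 1 ≤ τ) : Integrable fun s : ℝ => (τ + s ^ 2)⁻¹ := by
  refine integrable_inv_one_add_sq.mono' (by fun_prop) (Eventually.of_forall fun s => ?_)
  rw [Real.norm_of_nonneg (by positivity)]
  exact inv_add_sq_le hτ s

theorem integrable_cauchyKernel_deriv {τ : ℝ} (hτ : 1 ≤ τ) :
    Integrable fun s : ℝ => -2 * s / (τ + s ^ 2) ^ 2 := by
  refine (integrable_cauchyKernel hτ).mono' (Measurable.aestronglyMeasurable (by fun_prop))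
    (Eventually.of_forall fun s => ?_)
  have hp : 0 < τ + s ^ 2 := by positivity
  rw [Real.norm_eq_abs, abs_div, abs_of_pos (pow_pos hp 2), div_le_iff₀ (pow_pos hp 2),
    pow_two (τ + s ^ 2), inv_mul_cancel_left₀ hp.ne', abs_le]
  constructor <;> nlinarith [sq_nonneg (s + 1), sq_nonneg (s - 1)]

section Walk

variable {Ω : Type*} [MeasurableSpace Ω] {P : Measure Ω} [IsProbabilityMeasure P] {X : Ω → ℝ}

/-- The defect `f - 𝔼 f(· + X)` of a bounded superharmonic function has a small integral against
the Cauchy kernel: by symmetry the kernel may be transported to `f`, and its first order variation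
vanishes on average because `X` is centered. -/
theorem integral_defect_mul_cauchyKernel_le (hX : Measurable X)
    (hX2 : Integrable (fun ω => X ω ^ 2) P) (hX1 : Integrable X P) (h0 : ∫ ω, X ω ∂P = 0)
    {f : ℝ → ℝ} (hf : Continuous f) {c : ℝ} (hf0 : ∀ s, 0 ≤ f s) (hfc : ∀ s, f s ≤ c)
    {τ : ℝ} (hτ : 1 ≤ τ) :
    Integrable (fun s => (f s - ∫ ω, f (s + X ω) ∂P) * (τ + s ^ 2)⁻¹) ∧
    ∫ s, (f s - ∫ ω, f (s + X ω) ∂P) * (τ + s ^ 2)⁻¹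
      ≤ 2 * c * (∫ ω, X ω ^ 2 ∂P) / τ * ∫ s : ℝ, (τ + s ^ 2)⁻¹ := by
  have hτ0 : 0 < τ := by linarith
  have hw := integrable_cauchyKernel hτ
  have hq := integrable_cauchyKernel_deriv hτ
  have hnorm : ∀ s, ‖f s‖ ≤ c := fun s => by
    rw [Real.norm_of_nonneg (hf0 s)]; exact hfc s
  have hbdd : ∀ {u : ℝ → ℝ}, Integrable u → Integrable fun s => f s * u s := fun hu =>
    hu.bdd_mul hf.aestronglyMeasurable (Eventually.of_forall hnorm)
  have hprod : Integrable (fun p : ℝ × Ω => f (p.1 + X p.2) * (τ + p.1 ^ 2)⁻¹)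
      (volume.prod P) := by
    refine (hw.comp_fst P).bdd_mul (c := c) ?_ (Eventually.of_forall fun p => hnorm _)
    exact (hf.measurable.comp (by fun_prop)).aestronglyMeasurable
  have hleft : Integrable fun s => (∫ ω, f (s + X ω) ∂P) * (τ + s ^ 2)⁻¹ := by
    refine hprod.integral_prod_left.congr (Eventually.of_forall fun s => ?_)
    exact integral_mul_const ((τ + s ^ 2)⁻¹) fun ω => f (s + X ω)
  have hsplit : (fun s => (f s - ∫ ω, f (s + X ω) ∂P) * (τ + s ^ 2)⁻¹)
      = fun s => f s * (τ + s ^ 2)⁻¹ - (∫ ω, f (s + X ω) ∂P) * (τ + s ^ 2)⁻¹ := by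
    funext s; ring
  rw [hsplit]
  refine ⟨(hbdd hw).sub hleft, ?_⟩
  rw [integral_sub (hbdd hw) hleft]
  have hswap : ∫ s, (∫ ω, f (s + X ω) ∂P) * (τ + s ^ 2)⁻¹
      = ∫ ω, (∫ s, f (s + X ω) * (τ + s ^ 2)⁻¹) ∂P := by
    rw [← integral_integral_swap hprod]
    exact integral_congr_ae (Eventually.of_forall fun s =>
      (integral_mul_const ((τ + s ^ 2)⁻¹) fun ω => f (s + X ω)).symm)
  have hDint : Integrable (fun ω => ∫ s, f (s + X ω) * (τ + s ^ 2)⁻¹) P := hprod.integral_prod_right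
  rw [hswap]
  have hconst : ∫ s, f s * (τ + s ^ 2)⁻¹ = ∫ _ω, (∫ s, f s * (τ + s ^ 2)⁻¹) ∂P := by simp
  rw [hconst, ← integral_sub (integrable_const _) hDint]
  set c₁ := ∫ s, f s * (-2 * s / (τ + s ^ 2) ^ 2)
  set I := ∫ s : ℝ, (τ + s ^ 2)⁻¹
  have hpt : ∀ ω, (∫ s, f s * (τ + s ^ 2)⁻¹) - ∫ s, f (s + X ω) * (τ + s ^ 2)⁻¹
      ≤ X ω * c₁ + X ω ^ 2 * (2 * c / τ * I) := by
    intro ω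
    have hsh : ∫ s, f (s + X ω) * (τ + s ^ 2)⁻¹ = ∫ s, f s * (τ + (s - X ω) ^ 2)⁻¹ := by
      rw [← integral_add_right_eq_self (fun s => f s * (τ + (s - X ω) ^ 2)⁻¹) (X ω)]
      simp
    have hw' : Integrable fun s : ℝ => (τ + (s - X ω) ^ 2)⁻¹ := hw.comp_sub_right (X ω)
    rw [hsh, ← integral_sub (hbdd hw) (hbdd hw')]
    have hR : X ω * c₁ + X ω ^ 2 * (2 * c / τ * I)
        = ∫ s, (X ω * (f s * (-2 * s / (τ + s ^ 2) ^ 2))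
          + X ω ^ 2 * (2 * c / τ) * (τ + s ^ 2)⁻¹) := by
      rw [integral_add ((hbdd hq).const_mul _) (hw.const_mul _), integral_const_mul,
        integral_const_mul]
      ring
    rw [hR]
    refine integral_mono ((hbdd hw).sub (hbdd hw'))
      (((hbdd hq).const_mul _).add (hw.const_mul _)) fun s => ?_
    have h1 := (le_abs_self _).trans (abs_cauchyKernel_expansion_le hτ0 s (X ω))
    have h2 : 0 ≤ 2 * X ω ^ 2 / τ * (τ + s ^ 2)⁻¹ := by positivity
    have h3 := mul_le_mul_of_nonneg_left h1 (hf0 s)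
    have h4 := mul_le_mul_of_nonneg_right (hfc s) h2
    have h5 : c * (2 * X ω ^ 2 / τ * (τ + s ^ 2)⁻¹) = X ω ^ 2 * (2 * c / τ) * (τ + s ^ 2)⁻¹ := by
      ring
    simp only
    rw [← h5]
    linarith
  calc _ ≤ ∫ ω, (X ω * c₁ + X ω ^ 2 * (2 * c / τ * I)) ∂P :=
        integral_mono ((integrable_const _).sub hDint)
          ((hX1.mul_const _).add (hX2.mul_const _)) hpt
    _ = _ := by
        rw [integral_add (hX1.mul_const _) (hX2.mul_const _), integral_mul_const,
          integral_mul_const, h0]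
        ring

/-- A bounded continuous superharmonic function of a centered random walk with finite variance is
harmonic. -/
theorem harmonic_of_bounded_superharmonic (hX : Measurable X)
    (hX2 : Integrable (fun ω => X ω ^ 2) P) (hX1 : Integrable X P) (h0 : ∫ ω, X ω ∂P = 0)
    {f : ℝ → ℝ} (hf : Continuous f) {c : ℝ} (hf0 : ∀ s, 0 ≤ f s) (hfc : ∀ s, f s ≤ c)
    (hsup : ∀ s, ∫ ω, f (s + X ω) ∂P ≤ f s) (s : ℝ) : ∫ ω, f (s + X ω) ∂P = f s := by
  have hPf : Continuous fun s => ∫ ω, f (s + X ω) ∂P := by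
    refine continuous_of_dominated (bound := fun _ => c)
      (fun s => (hf.measurable.comp (by fun_prop)).aestronglyMeasurable)
      (fun s => Eventually.of_forall fun ω => ?_) (integrable_const _)
      (Eventually.of_forall fun ω => by fun_prop)
    rw [Real.norm_of_nonneg (hf0 _)]
    exact hfc _
  set g : ℝ → ℝ := fun s => f s - ∫ ω, f (s + X ω) ∂P with hg
  have hgc : Continuous g := hf.sub hPf
  have hg0 : ∀ s, 0 ≤ g s := fun s => sub_nonneg.2 (hsup s)
  have hI : ∀ τ : ℝ, 1 ≤ τ → ∫ s, g s * (1 + s ^ 2)⁻¹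
      ≤ 2 * c * (∫ ω, X ω ^ 2 ∂P) * ∫ s : ℝ, (τ + s ^ 2)⁻¹ := by
    intro τ hτ
    have hτ0 : 0 < τ := by linarith
    obtain ⟨hi, hle⟩ := integral_defect_mul_cauchyKernel_le hX hX2 hX1 h0 hf hf0 hfc hτ
    obtain ⟨hi1, -⟩ := integral_defect_mul_cauchyKernel_le hX hX2 hX1 h0 hf hf0 hfc le_rfl
    calc ∫ s, g s * (1 + s ^ 2)⁻¹ ≤ ∫ s, τ * (g s * (τ + s ^ 2)⁻¹) := by
          refine integral_mono hi1 (hi.const_mul τ) fun s => ?_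
          have : (1 + s ^ 2)⁻¹ ≤ τ * (τ + s ^ 2)⁻¹ := by
            rw [← div_eq_mul_inv, inv_eq_one_div, div_le_div_iff₀ (by positivity) (by positivity)]
            nlinarith [sq_nonneg s]
          have := mul_le_mul_of_nonneg_left this (hg0 s)
          simp only
          linarith
      _ = τ * ∫ s, g s * (τ + s ^ 2)⁻¹ := integral_const_mul _ _
      _ ≤ τ * (2 * c * (∫ ω, X ω ^ 2 ∂P) / τ * ∫ s : ℝ, (τ + s ^ 2)⁻¹) :=
          mul_le_mul_of_nonneg_left hle hτ0.le
      _ = _ := by field_simp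
  have hlim : Tendsto (fun n : ℕ => ∫ s : ℝ, ((n : ℝ) + 1 + s ^ 2)⁻¹) atTop (𝓝 0) := by
    rw [← integral_zero ℝ ℝ (μ := volume)]
    refine tendsto_integral_of_dominated_convergence (fun s : ℝ => (1 + s ^ 2)⁻¹)
      (fun n => by fun_prop) integrable_inv_one_add_sq (fun n => Eventually.of_forall fun s => ?_)
      (Eventually.of_forall fun s => ?_)
    · rw [Real.norm_of_nonneg (by positivity)]
      exact inv_add_sq_le (by linarith [(Nat.cast_nonneg n : (0 : ℝ) ≤ n)]) s
    · refine tendsto_inv_atTop_zero.comp ?_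
      exact tendsto_atTop_add_const_right _ _
        (tendsto_atTop_add_const_right _ _ tendsto_natCast_atTop_atTop)
  have hle0 : ∫ s, g s * (1 + s ^ 2)⁻¹ ≤ 0 := by
    have := hlim.const_mul (2 * c * ∫ ω, X ω ^ 2 ∂P)
    rw [mul_zero] at this
    exact ge_of_tendsto' this fun n => hI _ (by linarith [(Nat.cast_nonneg n : (0 : ℝ) ≤ n)])
  have hnn : ∀ s, 0 ≤ g s * (1 + s ^ 2)⁻¹ := fun s => mul_nonneg (hg0 s) (by positivity)
  have hae := (integral_eq_zero_iff_of_nonneg hnn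
    (integral_defect_mul_cauchyKernel_le hX hX2 hX1 h0 hf hf0 hfc le_rfl).1).1
    (le_antisymm hle0 (integral_nonneg hnn))
  have hcont : Continuous fun s : ℝ => g s * (1 + s ^ 2)⁻¹ :=
    hgc.mul (Continuous.inv₀ (by fun_prop) fun s => by positivity)
  have hz := congrFun (hcont.ae_eq_iff_eq volume continuous_zero |>.1 hae) s
  have hz' : g s = 0 := by
    rcases mul_eq_zero.1 hz with h | h
    · exact h
    · exact absurd h (by positivity)
  simp only [hg] at hz'
  linarith

/-- **Liouville property.** A nonnegative continuous superharmonic function of a centered random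
walk with finite variance is invariant under almost every increment. -/
theorem ae_eq_of_superharmonic (hX : Measurable X)
    (hX2 : Integrable (fun ω => X ω ^ 2) P) (hX1 : Integrable X P) (h0 : ∫ ω, X ω ∂P = 0)
    {f : ℝ → ℝ} (hf : Continuous f) (hf0 : ∀ s, 0 ≤ f s)
    (hsup : ∀ s, ∫⁻ ω, ENNReal.ofReal (f (s + X ω)) ∂P ≤ ENNReal.ofReal (f s)) (s : ℝ) :
    ∀ᵐ ω ∂P, f (s + X ω) = f s := by
  have hmeas : ∀ s, Measurable fun ω => f (s + X ω) := fun s => hf.measurable.comp (by fun_prop)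
  have hint : ∀ s, Integrable (fun ω => f (s + X ω)) P := fun s =>
    ⟨(hmeas s).aestronglyMeasurable, by
      rw [hasFiniteIntegral_iff_ofReal (Eventually.of_forall fun ω => hf0 _)]
      exact (hsup s).trans_lt ENNReal.ofReal_lt_top⟩
  have hle : ∀ s, ∫ ω, f (s + X ω) ∂P ≤ f s := fun s => by
    rw [integral_eq_lintegral_of_nonneg_ae (Eventually.of_forall fun ω => hf0 _)
      (hmeas s).aestronglyMeasurable]
    exact ENNReal.toReal_le_of_le_ofReal (hf0 s) (hsup s)
  -- truncations are bounded and superharmonic, hence harmonic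
  have htrunc : ∀ c : ℝ, 0 ≤ c → ∀ s, ∫ ω, min (f (s + X ω)) c ∂P = min (f s) c := by
    intro c hc
    have hic : ∀ s, Integrable (fun ω => min (f (s + X ω)) c) P := fun s =>
      (hint s).inf (integrable_const c)
    refine harmonic_of_bounded_superharmonic (f := fun s => min (f s) c) hX hX2 hX1 h0
      (hf.min continuous_const) (fun s => le_min (hf0 s) hc) (fun s => min_le_right _ _)
      (fun s => le_min ?_ ?_)
    · exact (integral_mono (hic s) (hint s) fun ω => min_le_left _ _).trans (hle s)
    · exact (integral_mono (hic s) (integrable_const c) fun ω => min_le_right _ _).trans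
        (by simp)
  have hic : ∀ c, Integrable (fun ω => min (f (s + X ω)) c) P := fun c =>
    (hint s).inf (integrable_const c)
  -- truncating at the value `f s` itself: a mean equal to the maximum is attained almost surely
  have hge : ∀ᵐ ω ∂P, f s ≤ f (s + X ω) := by
    have h1 := htrunc (f s) (hf0 s) s
    have h2 : ∫ ω, (f s - min (f (s + X ω)) (f s)) ∂P = 0 := by
      rw [integral_sub (integrable_const _) (hic _), h1]
      simp
    rw [integral_eq_zero_iff_of_nonneg (fun ω => sub_nonneg.2 (min_le_right _ _))
      ((integrable_const _).sub (hic _))] at h2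
    filter_upwards [h2] with ω hω
    have : f s - min (f (s + X ω)) (f s) = 0 := hω
    exact (by linarith : f s = min (f (s + X ω)) (f s)).le.trans (min_le_left _ _)
  -- truncating strictly above the value `f s` now excludes values larger than `f s`
  have h1 := htrunc (f s + 1) (by linarith [hf0 s]) s
  rw [min_eq_left (by linarith)] at h1
  have h2 : ∫ ω, (min (f (s + X ω)) (f s + 1) - f s) ∂P = 0 := by
    rw [integral_sub (hic _) (integrable_const _), h1]
    simp
  have hnn : 0 ≤ᵐ[P] fun ω => min (f (s + X ω)) (f s + 1) - f s := by
    filter_upwards [hge] with ω hω using sub_nonneg.2 (le_min hω (by linarith))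
  rw [integral_eq_zero_iff_of_nonneg_ae hnn ((hic _).sub (integrable_const _))] at h2
  filter_upwards [h2] with ω hω
  have h3 : min (f (s + X ω)) (f s + 1) - f s = 0 := hω
  rcases min_choice (f (s + X ω)) (f s + 1) with h | h <;> rw [h] at h3 <;> linarith

end Walk

section Invariant

variable {d : ℕ} {μ : Measure (AffGroup d)} {ν : Measure (Euc d)}

/-! ### The Harnack inequality at infinity -/

theorem measurable_log_scale : Measurable fun g : AffGroup d => Real.log (g.2 : ℝ) := by fun_prop

namespace HypothesisH

theorem integrable_log_sq [IsProbabilityMeasure μ] (h : HypothesisH μ) :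
    Integrable (fun g : AffGroup d => Real.log (g.2 : ℝ) ^ 2) μ := by
  obtain ⟨ε, hε, hfin⟩ := h.moment
  have hm : Measurable fun g : AffGroup d =>
      (|Real.log (g.2 : ℝ)| + Real.posLog ‖g.1‖) ^ (2 + ε) := by
    unfold Real.posLog
    fun_prop
  have hnn : ∀ g : AffGroup d, 0 ≤ |Real.log (g.2 : ℝ)| + Real.posLog ‖g.1‖ := fun g =>
    add_nonneg (abs_nonneg _) Real.posLog_nonneg
  have hi : Integrable (fun g : AffGroup d =>
      (|Real.log (g.2 : ℝ)| + Real.posLog ‖g.1‖) ^ (2 + ε)) μ :=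
    ⟨hm.aestronglyMeasurable, by
      rw [hasFiniteIntegral_iff_ofReal
        (Eventually.of_forall fun g => Real.rpow_nonneg (hnn g) _)]
      exact hfin⟩
  refine ((integrable_const (1 : ℝ)).add hi).mono'
    (measurable_log_scale.pow_const 2).aestronglyMeasurable (Eventually.of_forall fun g => ?_)
  rw [Real.norm_of_nonneg (sq_nonneg _), ← sq_abs]
  have h1 : |Real.log (g.2 : ℝ)| ≤ |Real.log (g.2 : ℝ)| + Real.posLog ‖g.1‖ :=
    le_add_of_nonneg_right Real.posLog_nonneg
  set y := |Real.log (g.2 : ℝ)| + Real.posLog ‖g.1‖ with hy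
  have h2 : |Real.log (g.2 : ℝ)| ^ 2 ≤ y ^ 2 := pow_le_pow_left₀ (abs_nonneg _) h1 2
  have h3 : 0 ≤ y ^ (2 + ε) := Real.rpow_nonneg (hnn g) _
  simp only [Pi.add_apply]
  rcases le_total y 1 with hy1 | hy1
  · have : y ^ 2 ≤ 1 := pow_le_one₀ (hnn g) hy1
    linarith
  · have : y ^ (2 : ℝ) ≤ y ^ (2 + ε) := Real.rpow_le_rpow_of_exponent_le hy1 (by linarith)
    rw [Real.rpow_two] at this
    linarith

theorem integrable_log [IsProbabilityMeasure μ] (h : HypothesisH μ) :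
    Integrable (fun g : AffGroup d => Real.log (g.2 : ℝ)) μ :=
  ((memLp_two_iff_integrable_sq measurable_log_scale.aestronglyMeasurable).2
    h.integrable_log_sq).integrable (by norm_num)

theorem not_ae_log_eq_zero [IsProbabilityMeasure μ] (h : HypothesisH μ) :
    ¬ ∀ᵐ g ∂μ, Real.log (g.2 : ℝ) = 0 := by
  intro hae
  refine h.scale_nontrivial.ne ?_
  rw [← measure_univ (μ := μ)]
  refine measure_congr ?_
  filter_upwards [hae] with g hg
  refine propext ⟨fun _ => trivial, fun _ => ?_⟩
  exact Subtype.ext (Real.eq_one_of_pos_of_log_eq_zero g.2.2 hg)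

theorem measure_one_lt_scale_ne_zero [IsProbabilityMeasure μ] (h : HypothesisH μ) :
    μ {g | 1 < (g.2 : ℝ)} ≠ 0 := by
  intro h0
  refine h.not_ae_log_eq_zero ?_
  have hle : ∀ᵐ g ∂μ, 0 ≤ -Real.log (g.2 : ℝ) := by
    have : ∀ᵐ g ∂μ, ¬ 1 < ((g.2 : PosReal) : ℝ) := measure_eq_zero_iff_ae_notMem.1 h0
    filter_upwards [this] with g hg
    exact neg_nonneg.2 (Real.log_nonpos g.2.2.le (not_lt.1 hg))
  have := (integral_eq_zero_iff_of_nonneg_ae hle h.integrable_log.neg).1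
    (by rw [integral_neg, h.centered, neg_zero])
  filter_upwards [this] with g hg
  exact neg_eq_zero.1 hg

theorem measure_scale_lt_one_ne_zero [IsProbabilityMeasure μ] (h : HypothesisH μ) :
    μ {g | (g.2 : ℝ) < 1} ≠ 0 := by
  intro h0
  refine h.not_ae_log_eq_zero ?_
  have hle : ∀ᵐ g ∂μ, 0 ≤ Real.log (g.2 : ℝ) := by
    have : ∀ᵐ g ∂μ, ¬ ((g.2 : PosReal) : ℝ) < 1 := measure_eq_zero_iff_ae_notMem.1 h0
    filter_upwards [this] with g hg
    exact Real.log_nonneg (not_lt.1 hg)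
  exact (integral_eq_zero_iff_of_nonneg_ae hle h.integrable_log).1 h.centered

end HypothesisH

/-- The basic lower bound drawn from invariance: if all maps in `U` send `T` into `S`, then
`μ U * ν T ≤ ν S`. -/
theorem measure_mul_le_of_mapsTo [SFinite μ] [SFinite ν] (hinv : affConv μ ν = ν)
    {U : Set (AffGroup d)} {S T : Set (Euc d)} (hS : MeasurableSet S)
    (h : ∀ g ∈ U, ∀ x ∈ T, affAct g x ∈ S) : μ U * ν T ≤ ν S := by
  rw [← Measure.prod_prod]
  conv_rhs => rw [← hinv, affConv, Measure.map_apply measurable_affAct hS]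
  exact measure_mono fun p hp => h p.1 hp.1 p.2 hp.2

/-- Almost every map leaves the support of an invariant measure stable. -/
theorem ae_mapsTo_support [SFinite μ] [SFinite ν] (hinv : affConv μ ν = ν) :
    ∀ᵐ g ∂μ, ∀ x ∈ ν.support, affAct g x ∈ ν.support := by
  have h0 : ∀ᵐ y ∂(affConv μ ν), y ∈ ν.support := by
    rw [hinv]
    exact Measure.support_mem_ae
  have h1 := Measure.ae_ae_of_ae_prod (ae_of_ae_map measurable_affAct.aemeasurable h0)
  filter_upwards [h1] with g hg x hx
  by_contra hn
  have hcont : Continuous fun x : Euc d => affAct g x := by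
    unfold affAct
    fun_prop
  have hnhds : {x | affAct g x ∉ ν.support} ∈ 𝓝 x :=
    (Measure.isOpen_compl_support.preimage hcont).mem_nhds hn
  exact ((Measure.mem_support_iff_forall x).1 hx _ hnhds).ne' (by simpa [ae_iff] using hg)

theorem affAct_sub (g : AffGroup d) (x y : Euc d) :
    affAct g x - affAct g y = (g.2 : ℝ) • (x - y) := by
  simp [affAct, smul_sub]

/-- A nonzero invariant measure charges every neighbourhood of infinity: otherwise its support
would be bounded, and stable under an expanding map, hence a common fixed point. -/
theorem measure_norm_ge_ne_zero [IsProbabilityMeasure μ] [SFinite ν] (hH : HypothesisH μ)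
    (hne : ν ≠ 0) (hinv : affConv μ ν = ν) (r : ℝ) : ν {x | r ≤ ‖x‖} ≠ 0 := by
  intro h0
  have hbdd : ∀ x ∈ ν.support, ‖x‖ ≤ r := by
    intro x hx
    by_contra hn
    have : {x : Euc d | r < ‖x‖} ∈ 𝓝 x :=
      (isOpen_lt continuous_const continuous_norm).mem_nhds (not_le.1 hn)
    exact ((Measure.mem_support_iff_forall x).1 hx _ this).ne'
      (measure_mono_null (fun y (hy : r < ‖y‖) => hy.le) h0)
  have hB : Bornology.IsBounded ν.support :=
    isBounded_iff_forall_norm_le.2 ⟨r, hbdd⟩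
  have hst := ae_mapsTo_support hinv
  obtain ⟨g, hg1, hg⟩ : ∃ g : AffGroup d, 1 < (g.2 : ℝ) ∧
      ∀ x ∈ ν.support, affAct g x ∈ ν.support := by
    by_contra! hcon
    refine hH.measure_one_lt_scale_ne_zero (measure_eq_zero_iff_ae_notMem.2 ?_)
    filter_upwards [hst] with g hg hlt
    obtain ⟨x, hx, hx'⟩ := hcon g hlt
    exact hx' (hg x hx)
  have hdiam : Metric.diam ν.support ≤ Metric.diam ν.support / (g.2 : ℝ) := by
    refine Metric.diam_le_of_forall_dist_le (div_nonneg Metric.diam_nonneg g.2.2.le)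
      fun x hx y hy => ?_
    rw [le_div_iff₀ g.2.2]
    have := Metric.dist_le_diam_of_mem hB (hg x hx) (hg y hy)
    rwa [dist_eq_norm, affAct_sub, norm_smul, Real.norm_of_nonneg g.2.2.le, ← dist_eq_norm,
      mul_comm] at this
  have hd0 : Metric.diam ν.support = 0 := by
    rw [le_div_iff₀ g.2.2] at hdiam
    nlinarith [Metric.diam_nonneg (s := ν.support)]
  obtain ⟨x, hx⟩ := Measure.nonempty_support hne
  refine (hH.no_fixed_point x).ne ?_
  rw [← measure_univ (μ := μ)]
  refine measure_congr ?_
  filter_upwards [hst] with g hg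
  refine propext ⟨fun _ => trivial, fun _ => ?_⟩
  have := Metric.dist_le_diam_of_mem hB (hg x hx) hx
  rw [hd0] at this
  exact dist_le_zero.1 this

theorem norm_affAct_le (g : AffGroup d) (x : Euc d) :
    ‖affAct g x‖ ≤ (g.2 : ℝ) * ‖x‖ + ‖g.1‖ := by
  refine (norm_add_le _ _).trans ?_
  rw [norm_smul, Real.norm_of_nonneg g.2.2.le]

theorem le_norm_affAct (g : AffGroup d) (x : Euc d) :
    (g.2 : ℝ) * ‖x‖ - ‖g.1‖ ≤ ‖affAct g x‖ := by
  have := norm_sub_norm_le ((g.2 : ℝ) • x) (-g.1)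
  rwa [sub_neg_eq_add, norm_neg, norm_smul, Real.norm_of_nonneg g.2.2.le] at this

/-- With positive probability the maps expand, respectively contract, all large vectors by a factor
between `θ` and `W`. -/
theorem exists_expanding_contracting [IsProbabilityMeasure μ] (hH : HypothesisH μ) :
    ∃ θ W r₀ : ℝ, 1 < θ ∧ 1 ≤ W ∧ 1 ≤ r₀ ∧ ∃ U D : Set (AffGroup d), μ U ≠ 0 ∧ μ D ≠ 0 ∧
      (∀ g ∈ U, ∀ x, r₀ ≤ ‖x‖ → θ * ‖x‖ ≤ ‖affAct g x‖ ∧ ‖affAct g x‖ ≤ W * ‖x‖) ∧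
      (∀ g ∈ D, ∀ x, r₀ ≤ ‖x‖ → ‖x‖ ≤ W * ‖affAct g x‖ ∧ θ * ‖affAct g x‖ ≤ ‖x‖) := by
  -- with `θ = 1 + 1 / N`, half of the margin `2 / N` pays for the translation part on vectors
  -- of norm at least `2 * N ^ 2`
  let U : ℝ → Set (AffGroup d) := fun N => {g | 1 + 2 / N ≤ (g.2 : ℝ) ∧ (g.2 : ℝ) ≤ N ∧ ‖g.1‖ ≤ N}
  let D : ℝ → Set (AffGroup d) := fun N => {g | 1 / N ≤ (g.2 : ℝ) ∧ (g.2 : ℝ) ≤ 1 - 2 / N ∧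
    ‖g.1‖ ≤ N}
  have hU : ∃ n : ℕ, μ (U (n + 1)) ≠ 0 := by
    by_contra! hcon
    refine hH.measure_one_lt_scale_ne_zero (measure_mono_null (fun g hg => ?_)
      (measure_iUnion_null hcon))
    have hg : 1 < (g.2 : ℝ) := hg
    obtain ⟨n, hn⟩ := exists_nat_ge (max (2 / ((g.2 : ℝ) - 1)) (max (g.2 : ℝ) ‖g.1‖))
    simp only [max_le_iff] at hn
    refine Set.mem_iUnion.2 ⟨n, ?_, by linarith [hn.2.1], by linarith [hn.2.2]⟩
    have h1 := hn.1
    rw [div_le_iff₀ (by linarith)] at h1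
    have : 2 / ((n : ℝ) + 1) ≤ (g.2 : ℝ) - 1 := by
      rw [div_le_iff₀ (by positivity)]
      nlinarith
    linarith
  have hD : ∃ n : ℕ, μ (D (n + 1)) ≠ 0 := by
    by_contra! hcon
    refine hH.measure_scale_lt_one_ne_zero (measure_mono_null (fun g hg => ?_)
      (measure_iUnion_null hcon))
    have hg : (g.2 : ℝ) < 1 := hg
    have hpos : 0 < (g.2 : ℝ) := g.2.2
    obtain ⟨n, hn⟩ := exists_nat_ge (max (2 / (1 - (g.2 : ℝ))) (max (1 / (g.2 : ℝ)) ‖g.1‖))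
    simp only [max_le_iff] at hn
    refine Set.mem_iUnion.2 ⟨n, ?_, ?_, by linarith [hn.2.2]⟩
    · have h1 := hn.2.1
      rw [div_le_iff₀ hpos] at h1
      rw [div_le_iff₀ (by positivity)]
      nlinarith
    · have h1 := hn.1
      rw [div_le_iff₀ (by linarith)] at h1
      have : 2 / ((n : ℝ) + 1) ≤ 1 - (g.2 : ℝ) := by
        rw [div_le_iff₀ (by positivity)]
        nlinarith
      linarith
  obtain ⟨n, hn⟩ := hU
  obtain ⟨m, hm⟩ := hD
  set N : ℝ := max (n : ℝ) m + 1 with hN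
  have hnN : (n : ℝ) + 1 ≤ N := by linarith [le_max_left (n : ℝ) m]
  have hmN : (m : ℝ) + 1 ≤ N := by linarith [le_max_right (n : ℝ) m]
  have hn0 : (0 : ℝ) < (n : ℝ) + 1 := by positivity
  have hm0 : (0 : ℝ) < (m : ℝ) + 1 := by positivity
  have hN1 : 1 ≤ N := by linarith [(Nat.cast_nonneg n : (0 : ℝ) ≤ n)]
  have hN0 : 0 < N := by linarith
  have hu : 0 < 1 / N := by positivity
  have hNu : N * (1 / N) = 1 := by field_simp
  have htwo : 2 / N = 2 * (1 / N) := by ring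
  generalize hudef : 1 / N = u at hu hNu htwo
  refine ⟨1 + u, 2 * N, 2 * N ^ 2, by linarith, by linarith, by nlinarith, U N, D N, ?_, ?_,
    fun g hg x hx => ?_, fun g hg x hx => ?_⟩
  · refine fun h0 => hn (measure_mono_null (t := U N) (fun g hg =>
      ⟨?_, hg.2.1.trans hnN, hg.2.2.trans hnN⟩) h0)
    have := div_le_div_of_nonneg_left (zero_le_two (α := ℝ)) hn0 hnN
    linarith [hg.1]
  · refine fun h0 => hm (measure_mono_null (t := D N) (fun g hg =>
      ⟨?_, ?_, hg.2.2.trans hmN⟩) h0)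
    · exact (one_div_le_one_div_of_le hm0 hmN).trans hg.1
    · have := div_le_div_of_nonneg_left (zero_le_two (α := ℝ)) hm0 hmN
      linarith [hg.2.1]
  all_goals
    have hup := norm_affAct_le g x
    have hlo := le_norm_affAct g x
    obtain ⟨h1, h2, h3⟩ := hg
    rw [htwo] at *
    have hx0 : 0 ≤ ‖x‖ := norm_nonneg x
    have hux : N ≤ u * ‖x‖ := by
      have := mul_le_mul_of_nonneg_left hx hu.le
      have h4 : u * (2 * N ^ 2) = 2 * N * (N * u) := by ring
      rw [h4, hNu] at this
      linarith
    have e1 := mul_le_mul_of_nonneg_right h1 hx0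
    have e2 := mul_le_mul_of_nonneg_right h2 hx0
  · refine ⟨by nlinarith, ?_⟩
    have : N * 1 ≤ N * ‖x‖ := mul_le_mul_of_nonneg_left (by nlinarith) hN0.le
    linarith
  · rw [hudef] at e1
    constructor
    · have : u * ‖x‖ - N ≤ ‖affAct g x‖ := by linarith
      have := mul_le_mul_of_nonneg_left this (by linarith : 0 ≤ 2 * N)
      have h4 : 2 * N * (u * ‖x‖ - N) = 2 * (N * u) * ‖x‖ - 2 * N ^ 2 := by ring
      rw [h4, hNu] at this
      linarith
    · have : ‖affAct g x‖ ≤ (1 - u) * ‖x‖ := by nlinarith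
      have := mul_le_mul_of_nonneg_left this (by linarith : 0 ≤ 1 + u)
      nlinarith [mul_nonneg (mul_nonneg hu.le hu.le) hx0]

/-- Elementary Harnack inequalities: widening a large annulus by the factor `θ`, outwards or
inwards, multiplies its mass by a bounded factor. -/
theorem exists_widening_bound [IsProbabilityMeasure μ] [SFinite ν] (hH : HypothesisH μ)
    (hinv : affConv μ ν = ν) :
    ∃ (θ W r₀ : ℝ) (K : ENNReal), 1 < θ ∧ 1 ≤ W ∧ 1 ≤ r₀ ∧ K ≠ ⊤ ∧ ∀ r t : ℝ, r₀ ≤ r →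
      (W * r ≤ t → ν (annulus d r (θ * t)) ≤ K * ν (annulus d r t)) ∧
      (W * (θ * r) ≤ t → ν (annulus d r t) ≤ K * ν (annulus d (θ * r) t)) := by
  obtain ⟨θ, W, r₀, hθ, hW, hr₀, U, D, hU, hD, hUb, hDb⟩ := exists_expanding_contracting hH
  have hfin : ∀ V : Set (AffGroup d), μ V ≠ 0 → ∀ S T : Set (Euc d),
      μ V * ν T ≤ ν S → ν T ≤ (μ V)⁻¹ * ν S := by
    intro V hV S T h
    rwa [mul_comm (μ V)⁻¹, ← div_eq_mul_inv, ENNReal.le_div_iff_mul_le (Or.inl hV)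
      (Or.inl (measure_ne_top _ _)), mul_comm]
  refine ⟨θ, W, r₀, 1 + (μ U)⁻¹ + (μ D)⁻¹, hθ, hW, hr₀, ?_,
    fun r t hr => ⟨fun ht => ?_, fun ht => ?_⟩⟩
  · simp [hU, hD]
  · have hrt : r ≤ t := by nlinarith
    have h1 : ν (annulus d t (θ * t)) ≤ (μ D)⁻¹ * ν (annulus d r t) := by
      refine hfin D hD _ _ (measure_mul_le_of_mapsTo hinv (measurableSet_annulus _ _) ?_)
      intro g hg x hx
      obtain ⟨h1, h2⟩ := hDb g hg x (by linarith [hx.1])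
      constructor
      · have : W * r ≤ W * ‖affAct g x‖ := by linarith [hx.1]
        exact le_of_mul_le_mul_left this (by linarith)
      · exact le_of_mul_le_mul_left (h2.trans hx.2) (by linarith)
    calc ν (annulus d r (θ * t)) ≤ ν (annulus d r t ∪ annulus d t (θ * t)) := by
          refine measure_mono fun x hx => ?_
          rcases le_total ‖x‖ t with h | h
          · exact Or.inl ⟨hx.1, h⟩
          · exact Or.inr ⟨h, hx.2⟩
      _ ≤ ν (annulus d r t) + (μ D)⁻¹ * ν (annulus d r t) :=
          (measure_union_le _ _).trans (add_le_add le_rfl h1)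
      _ = (1 + (μ D)⁻¹) * ν (annulus d r t) := by rw [add_mul, one_mul]
      _ ≤ _ := by gcongr; exact le_self_add
  · have h1 : ν (annulus d r (θ * r)) ≤ (μ U)⁻¹ * ν (annulus d (θ * r) t) := by
      refine hfin U hU _ _ (measure_mul_le_of_mapsTo hinv (measurableSet_annulus _ _) ?_)
      intro g hg x hx
      obtain ⟨h1, h2⟩ := hUb g hg x (by linarith [hx.1])
      constructor
      · nlinarith [hx.1]
      · nlinarith [hx.2]
    calc ν (annulus d r t) ≤ ν (annulus d (θ * r) t ∪ annulus d r (θ * r)) := by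
          refine measure_mono fun x hx => ?_
          rcases le_total ‖x‖ (θ * r) with h | h
          · exact Or.inr ⟨hx.1, h⟩
          · exact Or.inl ⟨h, hx.2⟩
      _ ≤ ν (annulus d (θ * r) t) + (μ U)⁻¹ * ν (annulus d (θ * r) t) :=
          (measure_union_le _ _).trans (add_le_add le_rfl h1)
      _ = (1 + (μ U)⁻¹) * ν (annulus d (θ * r) t) := by rw [add_mul, one_mul]
      _ ≤ _ := by exact mul_le_mul_left le_self_add _

/-- **Harnack inequality at infinity.** The masses of all dilated annuli are controlled by that of
one wide enough reference annulus, which is charged at every large scale. -/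
theorem exists_harnack [IsProbabilityMeasure μ] [SFinite ν] (hH : HypothesisH μ)
    (hne : ν ≠ 0) (hinv : affConv μ ν = ν) :
    ∃ W r₀ : ℝ, 1 ≤ W ∧ 1 ≤ r₀ ∧ (∀ z, r₀ ≤ z → ν (annulus d z (W * z)) ≠ 0) ∧
      ∀ α β : ℝ, 0 < α → ∃ (C : ENNReal) (z₁ : ℝ), C ≠ ⊤ ∧ ∀ z, z₁ ≤ z →
        ν (annulus d (α * z) (β * z)) ≤ C * ν (annulus d z (W * z)) := by
  obtain ⟨θ, W, r₀, K, hθ, hW, hr₀, hK, hKb⟩ := exists_widening_bound hH hinv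
  have hθ0 : 0 < θ := by linarith
  have hout : ∀ (j : ℕ) (r t : ℝ), r₀ ≤ r → W * r ≤ t →
      ν (annulus d r (θ ^ j * t)) ≤ K ^ j * ν (annulus d r t) := by
    intro j
    induction j with
    | zero => intro r t _ _; simp
    | succ j ih =>
      intro r t hr ht
      have ht0 : 0 ≤ t := by nlinarith
      have h1 : t ≤ θ ^ j * t := le_mul_of_one_le_left ht0 (one_le_pow₀ hθ.le)
      have h2 := (hKb r (θ ^ j * t) hr).1 (ht.trans h1)
      calc ν (annulus d r (θ ^ (j + 1) * t)) = ν (annulus d r (θ * (θ ^ j * t))) := by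
            rw [pow_succ', mul_assoc]
        _ ≤ K * (K ^ j * ν (annulus d r t)) := h2.trans (mul_le_mul_right (ih r t hr ht) K)
        _ = _ := by rw [pow_succ', mul_assoc]
  have hin : ∀ (i : ℕ) (r t : ℝ), r₀ ≤ r → W * (θ ^ i * r) ≤ t →
      ν (annulus d r t) ≤ K ^ i * ν (annulus d (θ ^ i * r) t) := by
    intro i
    induction i with
    | zero => intro r t _ _; simp
    | succ i ih =>
      intro r t hr ht
      have hr0 : 0 ≤ r := by linarith
      have h1 : r ≤ θ ^ i * r := le_mul_of_one_le_left hr0 (one_le_pow₀ hθ.le)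
      have h3 : θ ^ (i + 1) * r = θ * (θ ^ i * r) := by rw [pow_succ', mul_assoc]
      rw [h3] at ht ⊢
      have h2 := (hKb (θ ^ i * r) t (hr.trans h1)).2 ht
      have h4 : W * (θ ^ i * r) ≤ t := by
        refine (mul_le_mul_of_nonneg_left ?_ (by linarith)).trans ht
        exact le_mul_of_one_le_left (by positivity) hθ.le
      calc ν (annulus d r t) ≤ K ^ i * ν (annulus d (θ ^ i * r) t) := ih r t hr h4
        _ ≤ K ^ i * (K * ν (annulus d (θ * (θ ^ i * r)) t)) := mul_le_mul_right h2 _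
        _ = _ := by rw [pow_succ, mul_assoc]
  refine ⟨W, r₀, hW, hr₀, fun z hz h0 => ?_, fun α β hα => ?_⟩
  · refine measure_norm_ge_ne_zero hH hne hinv z (measure_mono_null (fun x hx => ?_)
      (measure_iUnion_null fun j : ℕ => ?_) (t := ⋃ j : ℕ, annulus d z (θ ^ j * (W * z))))
    · obtain ⟨j, hj⟩ := pow_unbounded_of_one_lt ‖x‖ hθ
      refine Set.mem_iUnion.2 ⟨j, hx, hj.le.trans (le_mul_of_one_le_right (by positivity) ?_)⟩
      nlinarith
    · exact le_zero_iff.1 ((hout j z (W * z) hz le_rfl).trans (by rw [h0, mul_zero]))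
  · obtain ⟨i, hi⟩ := pow_unbounded_of_one_lt α⁻¹ hθ
    obtain ⟨j, hj⟩ := pow_unbounded_of_one_lt β hθ
    have hi0 : 0 < θ ^ i := by positivity
    refine ⟨K ^ (i + j), θ ^ i * r₀, ENNReal.pow_ne_top hK, fun z hz => ?_⟩
    have hz0 : 0 ≤ z := le_trans (by positivity) hz
    have hzr : r₀ ≤ z / θ ^ i := by rwa [le_div_iff₀ hi0, mul_comm]
    have hzi : θ ^ i * (z / θ ^ i) = z := by field_simp
    have hWz : W * z ≤ θ ^ j * (W * z) :=
      le_mul_of_one_le_left (by positivity) (one_le_pow₀ hθ.le)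
    have hrz : r₀ ≤ z := by
      refine hzr.trans (div_le_self hz0 (one_le_pow₀ hθ.le))
    calc ν (annulus d (α * z) (β * z)) ≤ ν (annulus d (z / θ ^ i) (θ ^ j * (W * z))) := by
          refine measure_mono (annulus_subset ?_ ?_)
          · rw [div_eq_mul_inv, mul_comm]
            exact mul_le_mul_of_nonneg_right (by rw [inv_le_comm₀ hi0 hα]; exact hi.le) hz0
          · refine (mul_le_mul_of_nonneg_right hj.le hz0).trans ?_
            exact mul_le_mul_of_nonneg_left (le_mul_of_one_le_left hz0 hW) (by positivity)
      _ ≤ K ^ i * ν (annulus d z (θ ^ j * (W * z))) := by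
          have := hin i (z / θ ^ i) (θ ^ j * (W * z)) hzr (by rwa [hzi])
          rwa [hzi] at this
      _ ≤ K ^ i * (K ^ j * ν (annulus d z (W * z))) :=
          mul_le_mul_right (hout j z (W * z) hrz le_rfl) _
      _ = _ := by rw [pow_add, mul_assoc]

/-! ### Normalized measures -/

theorem dilate_apply (a : PosReal) (ρ : Measure (Euc d)) [SFinite ρ] {S : Set (Euc d)}
    (hS : MeasurableSet S) : dilate a ρ S = ρ {x | (a : ℝ) • x ∈ S} := by
  rw [dilate_eq_map, Measure.map_apply (by fun_prop) hS]
  rfl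

theorem integral_dilate (a : PosReal) (ρ : Measure (Euc d)) [SFinite ρ] {φ : Euc d → ℝ}
    (hφ : Continuous φ) : ∫ x, φ x ∂(dilate a ρ) = ∫ x, φ ((a : ℝ) • x) ∂ρ := by
  rw [dilate_eq_map, integral_map (by fun_prop) hφ.aestronglyMeasurable]

theorem smul_mem_annulus_iff {a : ℝ} (ha : 0 < a) (r t : ℝ) (x : Euc d) :
    a • x ∈ annulus d r t ↔ x ∈ annulus d (r / a) (t / a) := by
  simp only [annulus, Set.mem_ofPred_eq, norm_smul, Real.norm_of_nonneg ha.le, div_le_iff₀ ha,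
    le_div_iff₀ ha, mul_comm a]

/-- The normalized dilated measure `(δ_{(0,z⁻¹)} *_G ν) / L(z)`. -/
def normMeasure (ν : Measure (Euc d)) (L : PosReal → ℝ) (z : PosReal) : Measure (Euc d) :=
  ENNReal.ofReal (L z)⁻¹ • dilate z⁻¹ ν

theorem normValue_eq_integral {L : PosReal → ℝ} (hL : ∀ z, 0 < L z) (z : PosReal)
    (φ : Euc d → ℝ) : normValue ν L z φ = ∫ x, φ x ∂(normMeasure ν L z) := by
  rw [normMeasure, integral_smul_measure, ENNReal.toReal_ofReal (inv_nonneg.2 (hL z).le),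
    normValue, smul_eq_mul, div_eq_inv_mul]

theorem lintegral_normMeasure [SFinite ν] (L : PosReal → ℝ) (z : PosReal) {f : Euc d → ENNReal}
    (hf : Measurable f) : ∫⁻ y, f y ∂(normMeasure ν L z)
      = ENNReal.ofReal (L z)⁻¹ * ∫⁻ x, f ((z : ℝ)⁻¹ • x) ∂ν := by
  rw [normMeasure, lintegral_smul_measure, dilate_eq_map, lintegral_map hf (by fun_prop)]
  rfl

/-- `L` dominates the masses of all dilated annuli. -/
def DominatesAnnuli (ν : Measure (Euc d)) (L : PosReal → ℝ) : Prop :=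
  ∀ α β : ℝ, 0 < α → ∃ C : ℝ, 0 ≤ C ∧ ∀ z : PosReal, 1 ≤ z →
    ν (annulus d (α * z) (β * z)) ≤ ENNReal.ofReal (C * L z)

theorem DominatesAnnuli.normMeasure_le [SFinite ν] {L : PosReal → ℝ} (hL : ∀ z, 0 < L z)
    (hdom : DominatesAnnuli ν L) {α : ℝ} (hα : 0 < α) (β : ℝ) :
    ∃ C : ℝ, 0 ≤ C ∧ ∀ z : PosReal, 1 ≤ z →
      normMeasure ν L z (annulus d α β) ≤ ENNReal.ofReal C := by
  obtain ⟨C, hC0, hC⟩ := hdom α β hα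
  refine ⟨C, hC0, fun z hz => ?_⟩
  have hz0 : 0 < (z : ℝ) := z.2
  have hset : {x : Euc d | ((z⁻¹ : PosReal) : ℝ) • x ∈ annulus d α β}
      = annulus d (α * z) (β * z) := by
    ext x
    rw [Set.mem_ofPred_eq, smul_mem_annulus_iff (z⁻¹).2]
    simp [div_inv_eq_mul]
  rw [normMeasure, Measure.smul_apply, dilate_apply _ _ (measurableSet_annulus _ _), hset,
    smul_eq_mul]
  calc ENNReal.ofReal (L z)⁻¹ * ν (annulus d (α * z) (β * z))
      ≤ ENNReal.ofReal (L z)⁻¹ * ENNReal.ofReal (C * L z) := mul_le_mul_right (hC z hz) _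
    _ = ENNReal.ofReal C := by
        rw [← ENNReal.ofReal_mul (inv_nonneg.2 (hL z).le)]
        congr 1
        field_simp [(hL z).ne']

/-- Invariance of `ν` read on the normalized measures: the translation parts are divided by the
scale. -/
theorem lintegral_normMeasure_of_invariant [SFinite μ] [SFinite ν] (hinv : affConv μ ν = ν)
    (L : PosReal → ℝ) (z : PosReal) {f : Euc d → ENNReal} (hf : Measurable f) :
    ∫⁻ g, ∫⁻ y, f ((g.2 : ℝ) • y + (z : ℝ)⁻¹ • g.1) ∂(normMeasure ν L z) ∂μ
      = ∫⁻ y, f y ∂(normMeasure ν L z) := by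
  have h1 : ∀ g : AffGroup d, ∫⁻ y, f ((g.2 : ℝ) • y + (z : ℝ)⁻¹ • g.1) ∂(normMeasure ν L z)
      = ENNReal.ofReal (L z)⁻¹ * ∫⁻ x, f ((z : ℝ)⁻¹ • affAct g x) ∂ν := by
    intro g
    rw [lintegral_normMeasure L z (f := fun y => f ((g.2 : ℝ) • y + (z : ℝ)⁻¹ • g.1))
      (hf.comp (by fun_prop))]
    congr 1
    refine lintegral_congr fun x => ?_
    rw [affAct, smul_add, smul_comm]
  simp_rw [h1]
  have hm : Measurable fun y : Euc d => f ((z : ℝ)⁻¹ • y) := hf.comp (by fun_prop)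
  rw [lintegral_const_mul' _ _ ENNReal.ofReal_ne_top, ← lintegral_affConv μ ν hm, hinv,
    lintegral_normMeasure L z hf]

theorem smul_add_notMem_annulus {a α β : ℝ} (ha : 0 < a) (hβ : α ≤ β) {y b : Euc d}
    (hb : ‖b‖ ≤ α / 2) (hy : y ∉ annulus d (α / 2 / a) (2 * β / a)) :
    a • y + b ∉ annulus d α β := by
  intro h
  refine hy ?_
  rw [← smul_mem_annulus_iff ha]
  have h1 := norm_add_le (a • y) b
  have h2 := norm_sub_norm_le (a • y) (-b)
  rw [sub_neg_eq_add, norm_neg] at h2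
  exact ⟨by linarith [h.1], by linarith [h.2, norm_nonneg b]⟩

/-- Translation parts are negligible in the limit: along a sequence of scales tending to infinity
the affine map `(b, a)` acts on the limit of the normalized measures as the dilation by `a`. -/
theorem tendsto_integral_normMeasure_affine [SFinite ν] {L : PosReal → ℝ} (hL : ∀ z, 0 < L z)
    (hdom : DominatesAnnuli ν L) {zs : ℕ → PosReal} (hzs : Tendsto zs atTop atTop)
    {η : Measure (Euc d)} (hlim : NormTendsto ν L zs η) {φ : Euc d → ℝ} (hφ : Continuous φ)
    (hs : HasPuncturedCompactSupport φ) (g : AffGroup d) :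
    Tendsto (fun n => ∫ y, φ ((g.2 : ℝ) • y + (zs n : ℝ)⁻¹ • g.1) ∂(normMeasure ν L (zs n)))
      atTop (𝓝 (∫ y, φ ((g.2 : ℝ) • y) ∂η)) := by
  obtain ⟨α, β, hα, hβ, h0⟩ := hs.exists_annulus
  have ha : 0 < (g.2 : ℝ) := g.2.2
  set a := (g.2 : ℝ)
  have hz : ∀ b : Euc d, ‖b‖ ≤ α / 2 → ∀ y, y ∉ annulus d (α / 2 / a) (2 * β / a) →
      φ (a • y + b) = 0 := fun b hb y hy => h0 _ (smul_add_notMem_annulus ha hβ hb hy)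
  have hz0 : ∀ y, y ∉ annulus d (α / 2 / a) (2 * β / a) → φ (a • y) = 0 := fun y hy => by
    simpa using hz 0 (by rw [norm_zero]; positivity) y hy
  obtain ⟨C, hC0, hC⟩ := hdom.normMeasure_le hL (α := α / 2 / a) (by positivity) (2 * β / a)
  have hmain : Tendsto (fun n => ∫ y, φ (a • y) ∂(normMeasure ν L (zs n))) atTop
      (𝓝 (∫ y, φ (a • y) ∂η)) := by
    refine (hlim (fun y => φ (a • y)) (by fun_prop)
      (hasPuncturedCompactSupport_of_annulus (by positivity) hz0)).congr fun n => ?_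
    exact normValue_eq_integral hL _ _
  have hto0 : Tendsto (fun n => (zs n : ℝ)⁻¹ • g.1) atTop (𝓝 0) := by
    have h1 : Tendsto (fun n => (zs n : ℝ)) atTop atTop := by
      refine tendsto_atTop.2 fun c => ?_
      filter_upwards [hzs.eventually_ge_atTop ⟨max c 1, by positivity⟩] with n hn
      exact (le_max_left c 1).trans hn
    simpa using (tendsto_inv_atTop_zero.comp h1).smul_const g.1
  have huc : UniformContinuous φ := hs.1.uniformContinuous_of_continuous hφ
  have hdiff : Tendsto (fun n => ∫ y, φ (a • y + (zs n : ℝ)⁻¹ • g.1) ∂(normMeasure ν L (zs n))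
      - ∫ y, φ (a • y) ∂(normMeasure ν L (zs n))) atTop (𝓝 0) := by
    rw [Metric.tendsto_atTop']
    intro ε hε
    obtain ⟨δ, hδ, hδφ⟩ := Metric.uniformContinuous_iff.1 huc (ε / (C + 1)) (by positivity)
    have hev : ∀ᶠ n in atTop, ‖(zs n : ℝ)⁻¹ • g.1‖ < min δ (α / 2) := by
      have := hto0.norm
      rw [norm_zero] at this
      exact this.eventually_lt_const (by positivity)
    obtain ⟨n₀, hn₀⟩ := eventually_atTop.1 (hev.and (hzs.eventually_ge_atTop 1))
    refine ⟨n₀, fun n hn => ?_⟩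
    obtain ⟨hsmall, hge⟩ := hn₀ n hn.le
    have hb : ‖(zs n : ℝ)⁻¹ • g.1‖ ≤ α / 2 := hsmall.le.trans (min_le_right _ _)
    have hfin := (hC (zs n) hge).trans_lt ENNReal.ofReal_lt_top
    rw [dist_zero_right, Real.norm_eq_abs, ← integral_sub
      (integrable_of_annulus (by fun_prop) (hz _ hb) hfin)
      (integrable_of_annulus (by fun_prop) hz0 hfin)]
    refine (abs_integral_le_of_annulus (M := ε / (C + 1)) (fun y => ?_) (fun y hy => ?_) hC0
      (hC (zs n) hge)).trans_lt ?_
    · rw [← Real.dist_eq]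
      refine (hδφ ?_).le
      rw [dist_eq_norm, add_sub_cancel_left]
      exact hsmall.trans_le (min_le_left _ _)
    · rw [hz _ hb y hy, hz0 y hy, sub_zero]
    · rw [div_mul_eq_mul_div, div_lt_iff₀ (by positivity)]
      nlinarith
  simpa using hdiff.add hmain

/-! ### Invariance of the vague limits -/

/-- By Fatou's lemma, every vague limit of the normalized measures is superharmonic for the random
dilations by `A`. -/
theorem lintegral_integral_dilate_le [SFinite μ] [SFinite ν] (hinv : affConv μ ν = ν)
    {L : PosReal → ℝ} (hL : ∀ z, 0 < L z)
    (hdom : DominatesAnnuli ν L) {zs : ℕ → PosReal} (hzs : Tendsto zs atTop atTop)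
    {η : Measure (Euc d)} (hlim : NormTendsto ν L zs η) {φ : Euc d → ℝ} (hφ : Continuous φ)
    (hs : HasPuncturedCompactSupport φ) (hφ0 : ∀ x, 0 ≤ φ x) :
    ∫⁻ g, ENNReal.ofReal (∫ y, φ ((g.2 : ℝ) • y) ∂η) ∂μ ≤ ENNReal.ofReal (∫ y, φ y ∂η) := by
  let u : ℕ → AffGroup d → ENNReal := fun n g =>
    ∫⁻ y, ENNReal.ofReal (φ ((g.2 : ℝ) • y + (zs n : ℝ)⁻¹ • g.1)) ∂(normMeasure ν L (zs n))
  have hsf : ∀ z, SFinite (normMeasure ν L z) := fun z => by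
    unfold normMeasure dilate affConv
    infer_instance
  have hum : ∀ n, Measurable (u n) := fun n => by
    refine Measurable.lintegral_prod_right' (f := fun p : AffGroup d × Euc d =>
      ENNReal.ofReal (φ ((p.1.2 : ℝ) • p.2 + (zs n : ℝ)⁻¹ • p.1.1))) ?_
    exact (hφ.measurable.comp (by fun_prop)).ennreal_ofReal
  have hle : ∀ n (ψ : Euc d → ℝ), Continuous ψ → (∀ x, 0 ≤ ψ x) →
      ENNReal.ofReal (∫ y, ψ y ∂(normMeasure ν L (zs n)))
        ≤ ∫⁻ y, ENNReal.ofReal (ψ y) ∂(normMeasure ν L (zs n)) := fun n ψ hψ hψ0 => by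
    rw [integral_eq_lintegral_of_nonneg_ae (Eventually.of_forall hψ0) hψ.aestronglyMeasurable]
    exact ENNReal.ofReal_toReal_le
  have hpt : ∀ g : AffGroup d,
      ENNReal.ofReal (∫ y, φ ((g.2 : ℝ) • y) ∂η) ≤ liminf (fun n => u n g) atTop := by
    intro g
    have h1 := ENNReal.tendsto_ofReal
      (tendsto_integral_normMeasure_affine hL hdom hzs hlim hφ hs g)
    rw [← h1.liminf_eq]
    refine liminf_le_liminf (Eventually.of_forall fun n => ?_)
    exact hle n _ (by fun_prop) fun y => hφ0 _
  calc ∫⁻ g, ENNReal.ofReal (∫ y, φ ((g.2 : ℝ) • y) ∂η) ∂μ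
      ≤ ∫⁻ g, liminf (fun n => u n g) atTop ∂μ := lintegral_mono hpt
    _ ≤ liminf (fun n => ∫⁻ g, u n g ∂μ) atTop := lintegral_liminf_le hum
    _ = ENNReal.ofReal (∫ y, φ y ∂η) := by
        have h2 := ENNReal.tendsto_ofReal (hlim φ hφ hs)
        rw [← h2.liminf_eq]
        obtain ⟨α, β, hα, hβ, h0⟩ := hs.exists_annulus
        obtain ⟨C, hC0, hC⟩ := hdom.normMeasure_le hL hα β
        refine liminf_congr ?_
        filter_upwards [hzs.eventually_ge_atTop 1] with n hn
        have hint : Integrable φ (normMeasure ν L (zs n)) :=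
          integrable_of_annulus hφ h0 ((hC _ hn).trans_lt ENNReal.ofReal_lt_top)
        rw [normValue_eq_integral hL, ofReal_integral_eq_lintegral_ofReal hint
          (Eventually.of_forall hφ0)]
        exact lintegral_normMeasure_of_invariant hinv L (zs n)
          (f := fun y => ENNReal.ofReal (φ y)) hφ.measurable.ennreal_ofReal

/-- The integral of the dilates of a test function depends continuously on the logarithm of the
dilation factor. -/
theorem continuous_integral_exp_smul {ρ : Measure (Euc d)}
    (hρ : ∀ α β : ℝ, 0 < α → ρ (annulus d α β) < ⊤) {φ : Euc d → ℝ} (hφ : Continuous φ)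
    (hs : HasPuncturedCompactSupport φ) : Continuous fun s : ℝ => ∫ x, φ (Real.exp s • x) ∂ρ := by
  obtain ⟨α, β, hα, hβ, h0⟩ := hs.exists_annulus
  obtain ⟨M, hM⟩ := hφ.bounded_above_of_compact_support hs.1
  refine continuous_iff_continuousAt.2 fun s₀ => ?_
  let T : Set (Euc d) := annulus d (α / Real.exp (s₀ + 1)) (β / Real.exp (s₀ - 1))
  have hT : ρ T < ⊤ := hρ _ _ (by positivity)
  refine continuousAt_of_dominated (bound := T.indicator fun _ => M)
    (Eventually.of_forall fun s => Continuous.aestronglyMeasurable (by fun_prop)) ?_ ?_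
    (Eventually.of_forall fun x => by fun_prop)
  · filter_upwards [Ioo_mem_nhds (sub_one_lt s₀) (lt_add_one s₀)] with s hs'
    refine Eventually.of_forall fun x => ?_
    by_cases hx : x ∈ T
    · rw [Set.indicator_of_mem hx]
      exact hM _
    · rw [Set.indicator_of_notMem hx, h0, norm_zero]
      intro hmem
      rw [smul_mem_annulus_iff (Real.exp_pos s)] at hmem
      refine hx (annulus_subset ?_ ?_ hmem)
      · exact div_le_div_of_nonneg_left hα.le (Real.exp_pos _) (Real.exp_le_exp.2 hs'.2.le)
      · exact div_le_div_of_nonneg_left (by linarith) (Real.exp_pos _)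
          (Real.exp_le_exp.2 hs'.1.le)
  · exact (integrable_indicator_iff (measurableSet_annulus _ _)).2 (integrableOn_const hT.ne)

theorem HasPuncturedCompactSupport.comp_smul {φ : Euc d → ℝ} (hs : HasPuncturedCompactSupport φ)
    {a : ℝ} (ha : 0 < a) : HasPuncturedCompactSupport fun x => φ (a • x) := by
  obtain ⟨α, β, hα, hβ, h0⟩ := hs.exists_annulus
  refine hasPuncturedCompactSupport_of_annulus (α := α / a) (β := β / a) (by positivity)
    fun x hx => h0 _ ?_
  rwa [smul_mem_annulus_iff ha]

theorem IsPuncturedRadon.dilate {η : Measure (Euc d)} (h : IsPuncturedRadon η) (a : PosReal) :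
    IsPuncturedRadon (dilate a η) := by
  have := h.sigmaFinite
  have ha : (a : ℝ) ≠ 0 := a.2.ne'
  refine ⟨?_, fun K hK h0 => ?_⟩
  · rw [dilate_apply _ _ (measurableSet_singleton _)]
    convert h.zero_mass
    ext x
    simp [ha]
  · rw [dilate_apply _ _ hK.measurableSet]
    obtain ⟨α, β, hα, -, hsub⟩ := exists_annulus_of_isCompact hK h0
    refine (measure_mono fun x hx => ?_).trans_lt
      (h.annulus_lt_top (div_pos hα a.2) (β / (a : ℝ)))
    exact (smul_mem_annulus_iff a.2 α β x).1 (hsub hx)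

theorem dilate_dilate (a b : PosReal) (ρ : Measure (Euc d)) [SFinite ρ] :
    dilate a (dilate b ρ) = dilate (a * b) ρ := by
  rw [dilate_eq_map b, dilate_eq_map, dilate_eq_map, Measure.map_map (by fun_prop) (by fun_prop)]
  congr 1
  funext x
  simp [smul_smul]

theorem dilate_one (ρ : Measure (Euc d)) [SFinite ρ] : dilate 1 ρ = ρ := by
  rw [dilate_eq_map]
  simp

/-- The group of dilations that preserve a Radon measure on the punctured space. -/
def dilationStabilizer (η : Measure (Euc d)) [SFinite η] : Subgroup PosReal where
  carrier := {a | dilate a η = η}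
  one_mem' := dilate_one η
  mul_mem' := fun {a b} ha hb => by
    have ha : dilate a η = η := ha
    have hb : dilate b η = η := hb
    change dilate (a * b) η = η
    rw [← dilate_dilate, hb, ha]
  inv_mem' := fun {a} ha => by
    have ha : dilate a η = η := ha
    change dilate a⁻¹ η = η
    conv_lhs => rw [← ha]
    rw [dilate_dilate, inv_mul_cancel, dilate_one]

theorem mem_dilationStabilizer_iff {η : Measure (Euc d)} [SFinite η] (h : IsPuncturedRadon η)
    (a : PosReal) : a ∈ dilationStabilizer η ↔ ∀ φ : Euc d → ℝ, Continuous φ →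
      HasPuncturedCompactSupport φ → (∀ x, 0 ≤ φ x) →
        ∫ x, φ ((a : ℝ) • x) ∂η = ∫ x, φ x ∂η := by
  constructor
  · intro ha φ hφ _ _
    have ha : dilate a η = η := ha
    rw [← integral_dilate a η hφ, ha]
  · intro H
    refine (h.dilate a).ext_of_integral h fun φ hφ hs h0 => ?_
    rw [integral_dilate a η hφ, H φ hφ hs h0]

theorem isClosed_setOf_integral_smul_eq {η : Measure (Euc d)} (h : IsPuncturedRadon η)
    {φ : Euc d → ℝ} (hφ : Continuous φ) (hs : HasPuncturedCompactSupport φ) :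
    IsClosed {a : PosReal | ∫ x, φ ((a : ℝ) • x) ∂η = ∫ x, φ x ∂η} := by
  have hc := continuous_integral_exp_smul (fun α β hα => h.annulus_lt_top hα β) hφ hs
  have hlog : Continuous fun a : PosReal => Real.log (a : ℝ) :=
    Continuous.log continuous_subtype_val fun a => a.2.ne'
  refine isClosed_eq ((hc.comp hlog).congr fun a => ?_) continuous_const
  simp only [Function.comp_apply, Real.exp_log a.2]

/-- Vague limits of the normalized measures are preserved by the dilations in `G(μ_A)`. -/
theorem dilate_eq_of_mem_scaleGroup [IsProbabilityMeasure μ] (hH : HypothesisH μ) [SFinite ν]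
    (hinv : affConv μ ν = ν) {L : PosReal → ℝ} (hL : ∀ z, 0 < L z) (hdom : DominatesAnnuli ν L)
    {zs : ℕ → PosReal} (hzs : Tendsto zs atTop atTop) {η : Measure (Euc d)}
    (hη : IsPuncturedRadon η) (hlim : NormTendsto ν L zs η) {a : PosReal}
    (ha : a ∈ scaleGroup μ) : dilate a η = η := by
  have := hη.sigmaFinite
  suffices hle : scaleGroup μ ≤ dilationStabilizer η from hle ha
  refine sInf_le ⟨?_, fun a ha => ?_⟩
  · have : (dilationStabilizer η : Set PosReal) = ⋂ (φ : Euc d → ℝ) (_ : Continuous φ)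
        (_ : HasPuncturedCompactSupport φ) (_ : ∀ x, 0 ≤ φ x),
          {a : PosReal | ∫ x, φ ((a : ℝ) • x) ∂η = ∫ x, φ x ∂η} := by
      ext a
      simp only [SetLike.mem_coe, mem_dilationStabilizer_iff hη, Set.mem_iInter, Set.mem_ofPred_eq]
    rw [this]
    exact isClosed_iInter fun φ => isClosed_iInter fun hφ => isClosed_iInter fun hs =>
      isClosed_iInter fun _ => isClosed_setOf_integral_smul_eq hη hφ hs
  · refine (mem_dilationStabilizer_iff hη a).2 fun φ hφ hs h0 => ?_
    suffices hsub : (scaleLaw μ).support ⊆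
        {a : PosReal | ∫ x, φ ((a : ℝ) • x) ∂η = ∫ x, φ x ∂η} from hsub ha
    have hcl := isClosed_setOf_integral_smul_eq hη hφ hs
    refine Measure.support_subset_of_isClosed hcl ?_
    have hae := ae_eq_of_superharmonic (P := μ) measurable_log_scale hH.integrable_log_sq
      hH.integrable_log hH.centered
      (continuous_integral_exp_smul (fun α β hα => hη.annulus_lt_top hα β) hφ hs)
      (fun s => integral_nonneg fun x => h0 _) (fun s => ?_) 0
    · rw [scaleLaw, mem_ae_map_iff measurable_snd.aemeasurable hcl.measurableSet]
      filter_upwards [hae] with g hg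
      rw [zero_add, Real.exp_log g.2.2, Real.exp_zero] at hg
      simpa using hg
    · have := lintegral_integral_dilate_le hinv hL hdom hzs hlim
        (φ := fun x => φ (Real.exp s • x)) (by fun_prop) (hs.comp_smul (Real.exp_pos s))
        (fun x => h0 _)
      refine le_trans (le_of_eq ?_) this
      refine lintegral_congr fun g => ?_
      simp only [Real.exp_add, Real.exp_log g.2.2, smul_smul]

/-! ### The normalizing function -/

theorem annulus_lt_top [IsLocallyFiniteMeasure ν] (r t : ℝ) : ν (annulus d r t) < ⊤ :=
  (isCompact_annulus r t).measure_lt_top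

/-- The mass seen by a test function `φ` at the scale `exp s`. -/
def scaleProfile (ν : Measure (Euc d)) (φ : Euc d → ℝ) (s : ℝ) : ℝ :=
  ∫ x, φ (Real.exp (-s) • x) ∂ν

theorem continuous_scaleProfile (hν : ∀ α β : ℝ, 0 < α → ν (annulus d α β) < ⊤)
    {φ : Euc d → ℝ} (hφ : Continuous φ) (hs : HasPuncturedCompactSupport φ) :
    Continuous (scaleProfile ν φ) :=
  (continuous_integral_exp_smul hν hφ hs).comp continuous_neg

/-- The profile averaged over a window of logarithmic length `ℓ`. If `exp ℓ` is a period of the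
limit measures, this average is asymptotically insensitive to the phase of the scale. -/
def windowProfile (ν : Measure (Euc d)) (φ : Euc d → ℝ) (ℓ s : ℝ) : ℝ :=
  ∫ t in (0 : ℝ)..ℓ, scaleProfile ν φ (s + t)

theorem continuous_windowProfile (hν : ∀ α β : ℝ, 0 < α → ν (annulus d α β) < ⊤)
    {φ : Euc d → ℝ} (hφ : Continuous φ) (hs : HasPuncturedCompactSupport φ) (ℓ : ℝ) :
    Continuous (windowProfile ν φ ℓ) := by
  have hc := continuous_scaleProfile hν hφ hs
  exact intervalIntegral.continuous_parametric_intervalIntegral_of_continuous'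
    (f := fun s t => scaleProfile ν φ (s + t))
    (hc.comp (continuous_fst.add continuous_snd)) 0 ℓ

/-- The normalizing function: the windowed profile at scales beyond `exp s₀`, and `1` below. -/
def normalizer (ν : Measure (Euc d)) (φ : Euc d → ℝ) (ℓ s₀ : ℝ) (z : PosReal) : ℝ :=
  if s₀ ≤ Real.log (z : ℝ) then windowProfile ν φ ℓ (Real.log (z : ℝ)) else 1

theorem measurable_normalizer (hν : ∀ α β : ℝ, 0 < α → ν (annulus d α β) < ⊤)
    {φ : Euc d → ℝ} (hφ : Continuous φ) (hs : HasPuncturedCompactSupport φ) (ℓ s₀ : ℝ) :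
    Measurable (normalizer ν φ ℓ s₀) := by
  have hlog : Measurable fun z : PosReal => Real.log (z : ℝ) := by fun_prop
  exact Measurable.ite (measurableSet_le measurable_const hlog)
    ((continuous_windowProfile hν hφ hs ℓ).measurable.comp hlog) measurable_const

/-- What is needed of the reference data defining the normalizer: a cutoff function `φ` for an
annulus `1 ≤ ‖x‖ ≤ W` in which `ν` has positive mass at all scales beyond `exp s₀`, and which
controls all other annuli. -/
structure IsReference (ν : Measure (Euc d)) (φ : Euc d → ℝ) (W s₀ : ℝ) : Prop where
  continuous : Continuous φ
  nonneg : ∀ x, 0 ≤ φ x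
  le_one : ∀ x, φ x ≤ 1
  eq_one : ∀ x ∈ annulus d 1 W, φ x = 1
  eq_zero : ∀ x, x ∉ annulus d (1 / 2) (2 * W) → φ x = 0
  one_le : 1 ≤ W
  pos : ∀ z, Real.exp s₀ ≤ z → ν (annulus d z (W * z)) ≠ 0
  harnack : ∀ α β : ℝ, 0 < α → ∃ (C : ENNReal) (z₁ : ℝ), C ≠ ⊤ ∧ ∀ z, z₁ ≤ z →
    ν (annulus d (α * z) (β * z)) ≤ C * ν (annulus d z (W * z))

theorem exists_isReference [IsProbabilityMeasure μ] [SFinite ν] (hH : HypothesisH μ)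
    (hne : ν ≠ 0) (hinv : affConv μ ν = ν) :
    ∃ (φ : Euc d → ℝ) (W s₀ : ℝ), IsReference ν φ W s₀ := by
  obtain ⟨W, r₀, hW, hr₀, hpos, hh⟩ := exists_harnack hH hne hinv
  obtain ⟨φ, hc, h0, h1, hone, hzero⟩ := exists_cutoff (d := d) (α := 1) (β := W) one_pos
    (by linarith)
  exact ⟨φ, W, Real.log r₀, hc, h0, h1, hone, hzero, hW,
    fun z hz => hpos z (by rwa [Real.exp_log (by linarith)] at hz), hh⟩

/-- Along a sequence of scales whose normalized measures converge, so do the normalized values of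
the windowed profile at shifted scales. -/
theorem tendsto_windowProfile_div [IsLocallyFiniteMeasure ν] {L : PosReal → ℝ}
    (hL : ∀ z, 0 < L z) (hdom : DominatesAnnuli ν L) {zs : ℕ → PosReal}
    (hzs : Tendsto zs atTop atTop)
    {η : Measure (Euc d)} (hlim : NormTendsto ν L zs η) {φ : Euc d → ℝ} (hφ : Continuous φ)
    (hs : HasPuncturedCompactSupport φ) {ℓ : ℝ} (hℓ : 0 < ℓ) (u : ℝ) :
    Tendsto (fun n => windowProfile ν φ ℓ (Real.log (zs n : ℝ) + u) / L (zs n)) atTop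
      (𝓝 (windowProfile η φ ℓ u)) := by
  obtain ⟨α, β, hα, hβ, h0⟩ := hs.exists_annulus
  obtain ⟨M, hM⟩ := hφ.bounded_above_of_compact_support hs.1
  have hβ0 : 0 ≤ β := by linarith
  obtain ⟨C, hC0, hC⟩ := hdom.normMeasure_le hL (α := α * Real.exp u) (by positivity)
    (β * Real.exp (u + ℓ))
  have hν : ∀ α β : ℝ, 0 < α → ν (annulus d α β) < ⊤ := fun α β _ => annulus_lt_top α β
  have hval : ∀ (z : PosReal) (v : ℝ), scaleProfile ν φ (Real.log (z : ℝ) + v) / L z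
      = ∫ y, φ (Real.exp (-v) • y) ∂(normMeasure ν L z) := by
    intro z v
    rw [← normValue_eq_integral hL, normValue, integral_dilate _ _ (by fun_prop), scaleProfile]
    congr 1
    refine integral_congr_ae (Eventually.of_forall fun x => ?_)
    have : Real.exp (-(Real.log (z : ℝ) + v)) = Real.exp (-v) * ((z⁻¹ : PosReal) : ℝ) := by
      rw [neg_add_rev, Real.exp_add, Real.exp_neg (Real.log _), Real.exp_log z.2]
      rfl
    simp only [this, mul_smul]
  have hdiv : ∀ n, windowProfile ν φ ℓ (Real.log (zs n : ℝ) + u) / L (zs n)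
      = ∫ t in (0 : ℝ)..ℓ, ∫ y, φ (Real.exp (-(u + t)) • y) ∂(normMeasure ν L (zs n)) := by
    intro n
    rw [windowProfile, ← intervalIntegral.integral_div]
    refine intervalIntegral.integral_congr fun t _ => ?_
    simp only [add_assoc, hval]
  simp_rw [hdiv]
  unfold windowProfile
  refine intervalIntegral.tendsto_integral_filter_of_dominated_convergence (fun _ => M * C)
    ?_ ?_ intervalIntegrable_const ?_
  · refine Eventually.of_forall fun n => Continuous.aestronglyMeasurable ?_
    have hc : Continuous fun t => scaleProfile ν φ (Real.log (zs n : ℝ) + (u + t)) / L (zs n) :=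
      ((continuous_scaleProfile hν hφ hs).comp (by fun_prop)).div_const _
    exact hc.congr fun t => hval _ _
  · filter_upwards [hzs.eventually_ge_atTop 1] with n hn
    refine Eventually.of_forall fun t ht => ?_
    rw [Set.uIoc_of_le hℓ.le] at ht
    rw [Real.norm_eq_abs]
    refine abs_integral_le_of_annulus (fun y => hM _) (fun y hy => h0 _ fun hmem => hy ?_) hC0
      (hC _ hn)
    rw [smul_mem_annulus_iff (Real.exp_pos _), Real.exp_neg, div_inv_eq_mul, div_inv_eq_mul] at hmem
    refine annulus_subset ?_ ?_ hmem
    · exact mul_le_mul_of_nonneg_left (Real.exp_le_exp.2 (by linarith [ht.1])) hα.le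
    · exact mul_le_mul_of_nonneg_left (Real.exp_le_exp.2 (by linarith [ht.2])) hβ0
  · refine Eventually.of_forall fun t _ => ?_
    refine (hlim (fun y => φ (Real.exp (-(u + t)) • y)) (by fun_prop)
      (hs.comp_smul (Real.exp_pos _))).congr fun n => ?_
    exact normValue_eq_integral hL _ _

/-- If `η` is invariant under the dilation by `exp ℓ`, its windowed profile is constant. -/
theorem windowProfile_eq_of_dilate_eq {η : Measure (Euc d)} [SFinite η] {ℓ : ℝ}
    (hη : dilate ⟨Real.exp ℓ, Real.exp_pos ℓ⟩ η = η) {φ : Euc d → ℝ} (hφ : Continuous φ) (u : ℝ) :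
    windowProfile η φ ℓ u = windowProfile η φ ℓ 0 := by
  have hper : Function.Periodic (scaleProfile η φ) ℓ := fun t => by
    unfold scaleProfile
    conv_lhs => rw [← hη]
    rw [integral_dilate _ _ (by fun_prop)]
    simp only [smul_smul, ← Real.exp_add]
    simp
  unfold windowProfile
  simp only [intervalIntegral.integral_comp_add_left, add_zero]
  have := hper.intervalIntegral_add_eq u 0
  simpa using this

namespace IsReference

variable {φ : Euc d → ℝ} {W s₀ ℓ : ℝ}

theorem hasPuncturedCompactSupport (h : IsReference ν φ W s₀) : HasPuncturedCompactSupport φ :=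
  hasPuncturedCompactSupport_of_annulus (by norm_num) h.eq_zero

theorem annulus_le_scaleProfile [IsLocallyFiniteMeasure ν] (h : IsReference ν φ W s₀) (s : ℝ) :
    ν (annulus d (Real.exp s) (W * Real.exp s)) ≤ ENNReal.ofReal (scaleProfile ν φ s) := by
  have hint : Integrable (fun x => φ (Real.exp (-s) • x)) ν := by
    refine Continuous.integrable_of_hasCompactSupport (by have := h.continuous; fun_prop) ?_
    exact (h.hasPuncturedCompactSupport.comp_smul (Real.exp_pos _)).1
  rw [scaleProfile, ofReal_integral_eq_lintegral_ofReal hint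
    (Eventually.of_forall fun x => h.nonneg _),
    ← lintegral_indicator_one (measurableSet_annulus _ _)]
  refine lintegral_mono fun x => ?_
  refine Set.indicator_le' (f := 1) (g := fun x => ENNReal.ofReal (φ (Real.exp (-s) • x)))
    (fun y hy => ?_) (fun _ _ => zero_le) x
  rw [h.eq_one, ENNReal.ofReal_one, Pi.one_apply]
  rw [smul_mem_annulus_iff (Real.exp_pos _), Real.exp_neg, div_inv_eq_mul, div_inv_eq_mul, one_mul]
  exact hy

theorem scaleProfile_pos [IsLocallyFiniteMeasure ν] (h : IsReference ν φ W s₀) {s : ℝ}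
    (hs : s₀ ≤ s) : 0 < scaleProfile ν φ s := by
  have h1 := pos_iff_ne_zero.2 (h.pos _ (Real.exp_le_exp.2 hs))
  exact ENNReal.ofReal_pos.1 (h1.trans_le (h.annulus_le_scaleProfile s))

theorem continuous_scaleProfile_add [IsLocallyFiniteMeasure ν] (h : IsReference ν φ W s₀) (s : ℝ) :
    Continuous fun t => scaleProfile ν φ (s + t) :=
  (continuous_scaleProfile (fun α β _ => annulus_lt_top α β) h.continuous
    h.hasPuncturedCompactSupport).comp (continuous_const_add s)

theorem windowProfile_pos [IsLocallyFiniteMeasure ν] (h : IsReference ν φ W s₀) (hℓ : 0 < ℓ)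
    {s : ℝ} (hs : s₀ ≤ s) : 0 < windowProfile ν φ ℓ s :=
  intervalIntegral.intervalIntegral_pos_of_pos_on
    ((h.continuous_scaleProfile_add s).intervalIntegrable _ _)
    (fun t ht => h.scaleProfile_pos (by linarith [ht.1])) hℓ

theorem normalizer_pos [IsLocallyFiniteMeasure ν] (h : IsReference ν φ W s₀) (hℓ : 0 < ℓ)
    (z : PosReal) : 0 < normalizer ν φ ℓ s₀ z := by
  unfold normalizer
  split_ifs with hz
  · exact h.windowProfile_pos hℓ hz
  · exact one_pos

/-- By the Harnack inequality the windowed profile dominates the mass of the reference annulus. -/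
theorem exists_annulus_le_windowProfile [IsLocallyFiniteMeasure ν] (h : IsReference ν φ W s₀)
    (hℓ : 0 < ℓ) : ∃ C s₁ : ℝ, 0 ≤ C ∧ ∀ s, s₁ ≤ s →
      ν (annulus d (Real.exp s) (W * Real.exp s)) ≤ ENNReal.ofReal (C * windowProfile ν φ ℓ s) := by
  obtain ⟨C, z₁, hC, hCz⟩ := h.harnack (Real.exp (-ℓ)) W (Real.exp_pos _)
  obtain ⟨s₁, hs₁⟩ := (tendsto_atTop.1 Real.tendsto_exp_atTop z₁).exists_forall_of_atTop
  have hW0 : 0 ≤ W := by linarith [h.one_le]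
  refine ⟨C.toReal / ℓ, max s₁ s₀, by positivity, fun s hs => ?_⟩
  set m := ν (annulus d (Real.exp s) (W * Real.exp s)) with hm
  have hmt : m ≠ ⊤ := (annulus_lt_top _ _).ne
  have hpt : ∀ t ∈ Set.Icc 0 ℓ, m.toReal ≤ C.toReal * scaleProfile ν φ (s + t) := by
    intro t ht
    have hpos := h.scaleProfile_pos (s := s + t) (by linarith [le_max_right s₁ s₀, ht.1])
    have h1 : m ≤ C * ENNReal.ofReal (scaleProfile ν φ (s + t)) := by
      calc m ≤ ν (annulus d (Real.exp (-ℓ) * Real.exp (s + t)) (W * Real.exp (s + t))) := by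
            refine measure_mono (annulus_subset ?_ ?_)
            · rw [← Real.exp_add]
              exact Real.exp_le_exp.2 (by linarith [ht.2])
            · exact mul_le_mul_of_nonneg_left (Real.exp_le_exp.2 (by linarith [ht.1])) hW0
        _ ≤ C * ν (annulus d (Real.exp (s + t)) (W * Real.exp (s + t))) :=
            hCz _ (hs₁ _ (by linarith [le_max_left s₁ s₀, ht.1]))
        _ ≤ _ := mul_le_mul_right (h.annulus_le_scaleProfile _) _
    have h2 := ENNReal.toReal_mono (ENNReal.mul_ne_top hC ENNReal.ofReal_ne_top) h1
    rwa [ENNReal.toReal_mul, ENNReal.toReal_ofReal hpos.le] at h2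
  have hint : ∫ _t in (0 : ℝ)..ℓ, m.toReal
      ≤ ∫ t in (0 : ℝ)..ℓ, C.toReal * scaleProfile ν φ (s + t) :=
    intervalIntegral.integral_mono_on hℓ.le intervalIntegrable_const
      (((h.continuous_scaleProfile_add s).const_mul C.toReal).intervalIntegrable _ _) hpt
  rw [intervalIntegral.integral_const, intervalIntegral.integral_const_mul, sub_zero,
    smul_eq_mul] at hint
  refine ENNReal.le_ofReal_iff_toReal_le hmt ?_ |>.2 ?_
  · have := h.windowProfile_pos hℓ (s := s) (by linarith [le_max_right s₁ s₀])
    positivity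
  · rw [div_mul_eq_mul_div, le_div_iff₀ hℓ, mul_comm]
    exact hint

theorem dominatesAnnuli [IsLocallyFiniteMeasure ν] (h : IsReference ν φ W s₀) (hℓ : 0 < ℓ) :
    DominatesAnnuli ν (normalizer ν φ ℓ s₀) := by
  intro α β hα
  obtain ⟨C₁, z₁, hC₁, hz₁⟩ := h.harnack α β hα
  obtain ⟨C₂, s₁, hC₂, hs₁⟩ := h.exists_annulus_le_windowProfile hℓ
  have hexp : ∀ z : PosReal, Real.exp (Real.log (z : ℝ)) = z := fun z => Real.exp_log z.2
  let s₂ : ℝ := max (max s₀ s₁) (Real.log (max z₁ 1))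
  -- on the bounded range of scales the normalizer is bounded below, by compactness
  obtain ⟨c, hc0, hc⟩ : ∃ c : ℝ, 0 < c ∧ ∀ s ∈ Set.Icc s₀ s₂, c ≤ windowProfile ν φ ℓ s := by
    have hne : (Set.Icc s₀ s₂).Nonempty :=
      ⟨s₀, le_rfl, (le_max_left _ _).trans (le_max_left _ _)⟩
    obtain ⟨s, hs, hmin⟩ := isCompact_Icc.exists_isMinOn hne
      (continuous_windowProfile (ν := ν) (fun α β _ => annulus_lt_top α β) h.continuous
        h.hasPuncturedCompactSupport ℓ).continuousOn
    exact ⟨_, h.windowProfile_pos hℓ hs.1, fun t ht => hmin ht⟩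
  set B := (ν (annulus d 0 (|β| * Real.exp s₂))).toReal
  refine ⟨C₁.toReal * C₂ + B / min c 1, by positivity, fun z hz => ?_⟩
  have hLpos := h.normalizer_pos hℓ z
  rcases le_total s₂ (Real.log (z : ℝ)) with hs | hs
  · have hss₀ : s₀ ≤ Real.log (z : ℝ) := ((le_max_left _ _).trans (le_max_left _ _)).trans hs
    have hss₁ : s₁ ≤ Real.log (z : ℝ) := ((le_max_right _ _).trans (le_max_left _ _)).trans hs
    have hzz : z₁ ≤ z := by
      have h1 : Real.log (max z₁ 1) ≤ Real.log (z : ℝ) := (le_max_right _ _).trans hs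
      exact (le_max_left _ _).trans ((Real.log_le_log_iff (by positivity) z.2).1 h1)
    have hLz : normalizer ν φ ℓ s₀ z = windowProfile ν φ ℓ (Real.log (z : ℝ)) := if_pos hss₀
    have h2 := hs₁ _ hss₁
    rw [hexp, ← hLz] at h2
    calc ν (annulus d (α * z) (β * z)) ≤ C₁ * ν (annulus d z (W * z)) := hz₁ z hzz
      _ ≤ C₁ * ENNReal.ofReal (C₂ * normalizer ν φ ℓ s₀ z) := mul_le_mul_right h2 _
      _ = ENNReal.ofReal (C₁.toReal * C₂ * normalizer ν φ ℓ s₀ z) := by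
          rw [mul_assoc, ENNReal.ofReal_mul ENNReal.toReal_nonneg, ENNReal.ofReal_toReal hC₁]
      _ ≤ _ := by
          refine ENNReal.ofReal_le_ofReal (mul_le_mul_of_nonneg_right ?_ hLpos.le)
          exact le_add_of_nonneg_right (by positivity)
  · have hlow : min c 1 ≤ normalizer ν φ ℓ s₀ z := by
      unfold normalizer
      split_ifs with h0
      · exact (min_le_left _ _).trans (hc _ ⟨h0, hs⟩)
      · exact min_le_right _ _
    have hz2 : (z : ℝ) ≤ Real.exp s₂ := by
      rw [← hexp z]
      exact Real.exp_le_exp.2 hs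
    calc ν (annulus d (α * z) (β * z)) ≤ ν (annulus d 0 (|β| * Real.exp s₂)) := by
          refine measure_mono (annulus_subset (mul_nonneg hα.le z.2.le) ?_)
          exact mul_le_mul (le_abs_self β) hz2 z.2.le (abs_nonneg β)
      _ = ENNReal.ofReal B := (ENNReal.ofReal_toReal (annulus_lt_top _ _).ne).symm
      _ ≤ _ := by
          refine ENNReal.ofReal_le_ofReal ?_
          have h1 : B ≤ B / min c 1 * normalizer ν φ ℓ s₀ z := by
            rw [div_mul_eq_mul_div, le_div_iff₀ (by positivity)]
            exact mul_le_mul_of_nonneg_left hlow ENNReal.toReal_nonneg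
          have h2 : 0 ≤ C₁.toReal * C₂ * normalizer ν φ ℓ s₀ z := by positivity
          linarith

/-- Scales beyond the threshold are those that matter along sequences tending to infinity. -/
theorem eventually_normalizer_eq {zs : ℕ → PosReal} (hzs : Tendsto zs atTop atTop) (a : PosReal) :
    ∀ᶠ n in atTop, normalizer ν φ ℓ s₀ (a * zs n)
      = windowProfile ν φ ℓ (Real.log (zs n : ℝ) + Real.log (a : ℝ)) := by
  filter_upwards [hzs.eventually_ge_atTop (⟨Real.exp s₀, Real.exp_pos _⟩ * a⁻¹)] with n hn
  have h1 : Real.exp s₀ * (a : ℝ)⁻¹ ≤ zs n := hn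
  have h2 : Real.exp s₀ ≤ (a : ℝ) * zs n := by
    rwa [← div_eq_mul_inv, div_le_iff₀ a.2, mul_comm] at h1
  have h3 : Real.log (((a * zs n : PosReal)) : ℝ) = Real.log (zs n : ℝ) + Real.log (a : ℝ) := by
    rw [Positive.val_mul, Real.log_mul a.2.ne' (zs n).2.ne', add_comm]
  unfold normalizer
  rw [if_pos, h3]
  rw [Positive.val_mul, Real.le_log_iff_exp_le (mul_pos a.2 (zs n).2)]
  exact h2

theorem tendsto_normalizer_div [IsLocallyFiniteMeasure ν] (h : IsReference ν φ W s₀) (hℓ : 0 < ℓ)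
    {zs : ℕ → PosReal} (hzs : Tendsto zs atTop atTop) {η : Measure (Euc d)}
    (hlim : NormTendsto ν (normalizer ν φ ℓ s₀) zs η) (a : PosReal) :
    Tendsto (fun n => normalizer ν φ ℓ s₀ (a * zs n) / normalizer ν φ ℓ s₀ (zs n)) atTop
      (𝓝 (windowProfile η φ ℓ (Real.log (a : ℝ)))) := by
  refine (tendsto_windowProfile_div (h.normalizer_pos hℓ) (h.dominatesAnnuli hℓ) hzs hlim
    h.continuous h.hasPuncturedCompactSupport hℓ (Real.log (a : ℝ))).congr' ?_
  filter_upwards [eventually_normalizer_eq (ν := ν) (φ := φ) (ℓ := ℓ) (s₀ := s₀) hzs a] with n hn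
  rw [hn]

/-- The normalization gives the vague limits a windowed profile equal to one. -/
theorem windowProfile_eq_one [IsLocallyFiniteMeasure ν] (h : IsReference ν φ W s₀) (hℓ : 0 < ℓ)
    {zs : ℕ → PosReal} (hzs : Tendsto zs atTop atTop) {η : Measure (Euc d)}
    (hlim : NormTendsto ν (normalizer ν φ ℓ s₀) zs η) : windowProfile η φ ℓ 0 = 1 := by
  have h1 := h.tendsto_normalizer_div hℓ hzs hlim 1
  rw [show Real.log (((1 : PosReal)) : ℝ) = 0 from Real.log_one] at h1
  refine tendsto_nhds_unique h1 (tendsto_const_nhds.congr fun n => ?_)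
  rw [one_mul, div_self (h.normalizer_pos hℓ _).ne']

end IsReference

/-! ### Relative compactness and slow variation -/

/-- Weak relative compactness of the normalized measures. -/
theorem DominatesAnnuli.exists_subseq [SFinite ν] {L : PosReal → ℝ} (hL : ∀ z, 0 < L z)
    (hdom : DominatesAnnuli ν L) {zs : ℕ → PosReal} (hzs : ∀ n, 1 ≤ zs n) :
    ∃ (k : ℕ → ℕ) (η : Measure (Euc d)), StrictMono k ∧ IsPuncturedRadon η ∧
      NormTendsto ν L (zs ∘ k) η := by
  obtain ⟨k, η, hk, hη, hlim⟩ := exists_punctured_subseq (fun n => normMeasure ν L (zs n))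
    (fun α β hα => by
      obtain ⟨C, -, hC⟩ := hdom.normMeasure_le hL hα β
      exact ⟨C, fun n => hC _ (hzs n)⟩)
  refine ⟨k, η, hk, hη, fun φ hφ hs => (hlim φ hφ hs).congr fun n => ?_⟩
  exact (normValue_eq_integral hL _ _).symm

/-- The normalizer is slowly varying, provided `exp ℓ` belongs to `G(μ_A)`: all subsequential limits
of its ratios are ratios of windowed profiles of measures invariant under `exp ℓ`. -/
theorem IsReference.isSlowlyVarying_normalizer [IsProbabilityMeasure μ] (hH : HypothesisH μ)
    [IsLocallyFiniteMeasure ν] (hinv : affConv μ ν = ν) {φ : Euc d → ℝ} {W s₀ ℓ : ℝ}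
    (h : IsReference ν φ W s₀) (hℓ : 0 < ℓ)
    (hmem : (⟨Real.exp ℓ, Real.exp_pos ℓ⟩ : PosReal) ∈ scaleGroup μ) :
    IsSlowlyVarying (normalizer ν φ ℓ s₀) := by
  have hL := h.normalizer_pos hℓ
  have hdom := h.dominatesAnnuli hℓ
  refine ⟨hL, measurable_normalizer (fun α β _ => annulus_lt_top α β) h.continuous
    h.hasPuncturedCompactSupport ℓ s₀, fun a => ?_⟩
  by_contra hcon
  rw [Metric.tendsto_atTop] at hcon
  push Not at hcon
  obtain ⟨ε, hε, hbad⟩ := hcon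
  -- a sequence of scales along which the ratio stays away from `1`
  choose zs hzs hzsbad using fun n : ℕ => hbad ⟨(n : ℝ) + 1, by positivity⟩
  have hge : ∀ n : ℕ, (n : ℝ) + 1 ≤ (zs n : ℝ) := fun n => hzs n
  have hone : ∀ n, 1 ≤ zs n := fun n => by
    change (1 : ℝ) ≤ zs n
    linarith [hge n, (Nat.cast_nonneg n : (0 : ℝ) ≤ n)]
  have htop : Tendsto zs atTop atTop := by
    refine tendsto_atTop.2 fun b => ?_
    obtain ⟨N, hN⟩ := exists_nat_ge (b : ℝ)
    filter_upwards [eventually_ge_atTop N] with n hn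
    have : (N : ℝ) ≤ n := Nat.cast_le.2 hn
    change (b : ℝ) ≤ zs n
    linarith [hge n]
  obtain ⟨k, η, hk, hη, hlim⟩ := hdom.exists_subseq hL hone
  have htop' := htop.comp hk.tendsto_atTop
  have := hη.sigmaFinite
  have hdil := dilate_eq_of_mem_scaleGroup hH hinv hL hdom htop' hη hlim hmem
  have hconv := h.tendsto_normalizer_div hℓ htop' hlim a
  rw [windowProfile_eq_of_dilate_eq hdil h.continuous,
    h.windowProfile_eq_one hℓ htop' hlim] at hconv
  obtain ⟨n, hn⟩ := (Metric.tendsto_nhds.1 hconv ε hε).exists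
  exact absurd hn (not_lt.2 (hzsbad (k n)))

/-- `G(μ_A)` contains a dilation by some `exp ℓ > 1`. -/
theorem exists_exp_mem_scaleGroup [IsProbabilityMeasure μ] (hH : HypothesisH μ) :
    ∃ ℓ : ℝ, 0 < ℓ ∧ (⟨Real.exp ℓ, Real.exp_pos ℓ⟩ : PosReal) ∈ scaleGroup μ := by
  have hsupp : ∀ᵐ g ∂μ, g.2 ∈ (scaleLaw μ).support :=
    ae_of_ae_map measurable_snd.aemeasurable (Measure.support_mem_ae (μ := scaleLaw μ))
  obtain ⟨g, hg1, hg⟩ : ∃ g : AffGroup d, 1 < (g.2 : ℝ) ∧ g.2 ∈ (scaleLaw μ).support := by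
    by_contra! hcon
    refine hH.measure_one_lt_scale_ne_zero (measure_eq_zero_iff_ae_notMem.2 ?_)
    filter_upwards [hsupp] with g hg hlt
    exact hcon g hlt hg
  refine ⟨Real.log (g.2 : ℝ), Real.log_pos hg1, ?_⟩
  have : (⟨Real.exp (Real.log (g.2 : ℝ)), Real.exp_pos _⟩ : PosReal) = g.2 :=
    Subtype.ext (Real.exp_log g.2.2)
  rw [this]
  exact Subgroup.mem_sInf.2 fun H hHm => hHm.2 hg

/-! ### Integrability of negative powers of the norm -/

/-- Slow variation makes the masses of the geometric annuli subexponential, so that every negative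
power of the norm is integrable at infinity. -/
theorem integrable_one_add_norm_rpow [IsLocallyFiniteMeasure ν] {L : PosReal → ℝ}
    (hL : IsSlowlyVarying L) (hdom : DominatesAnnuli ν L) {γ : ℝ} (hγ : 0 < γ) :
    Integrable (fun x : Euc d => (1 + ‖x‖) ^ (-γ)) ν := by
  let e : ℕ → PosReal := fun n => ⟨Real.exp n, Real.exp_pos _⟩
  obtain ⟨C, hC0, hC⟩ := hdom 1 (Real.exp 1) one_pos
  have hetop : Tendsto e atTop atTop := by
    refine tendsto_atTop.2 fun b => ?_
    exact (Real.tendsto_exp_atTop.comp tendsto_natCast_atTop_atTop).eventually_ge_atTop (b : ℝ)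
  have hesucc : ∀ n, e (n + 1) = e 1 * e n := fun n => Subtype.ext (by
    simp only [e, Positive.val_mul, ← Real.exp_add]
    push_cast
    ring_nf)
  have hsum : Summable fun n : ℕ => Real.exp (-γ * n) * (C * L (e n)) := by
    have h1 : Summable fun n : ℕ => Real.exp (-γ * n) * L (e n) := by
      have hpos : ∀ n : ℕ, 0 < Real.exp (-γ * n) * L (e n) := fun n =>
        mul_pos (Real.exp_pos _) (hL.pos _)
      refine summable_of_ratio_test_tendsto_lt_one (l := Real.exp (-γ))
        (Real.exp_lt_one_iff.2 (by linarith)) (Eventually.of_forall fun n => (hpos n).ne') ?_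
      have h2 := ((hL.tendsto (e 1)).comp hetop).const_mul (Real.exp (-γ))
      rw [mul_one] at h2
      refine h2.congr fun n => ?_
      rw [Real.norm_of_nonneg (hpos _).le, Real.norm_of_nonneg (hpos _).le, hesucc n,
        show -γ * ((n + 1 : ℕ) : ℝ) = -γ + -γ * n by push_cast; ring, Real.exp_add,
        Function.comp_apply]
      have := (hL.pos (e n)).ne'
      have := (Real.exp_pos (-γ * n)).ne'
      field_simp
    refine (h1.mul_left C).congr fun n => ?_
    ring
  have hnn : ∀ x : Euc d, 0 ≤ (1 + ‖x‖) ^ (-γ) := fun x => Real.rpow_nonneg (by positivity) _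
  have hcont : Continuous fun x : Euc d => (1 + ‖x‖) ^ (-γ) :=
    Continuous.rpow_const (by fun_prop) fun x => Or.inl (by positivity)
  refine ⟨hcont.aestronglyMeasurable, ?_⟩
  rw [hasFiniteIntegral_iff_ofReal (Eventually.of_forall hnn)]
  let f : Euc d → ENNReal := fun x => ENNReal.ofReal ((1 + ‖x‖) ^ (-γ))
  have hcover : (Set.univ : Set (Euc d))
      ⊆ annulus d 0 1 ∪ ⋃ n : ℕ, annulus d (1 * (e n : ℝ)) (Real.exp 1 * e n) := by
    intro x _
    rcases le_total ‖x‖ 1 with hx | hx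
    · exact Or.inl ⟨norm_nonneg x, hx⟩
    · refine Or.inr (Set.mem_iUnion.2 ⟨⌊Real.log ‖x‖⌋₊, ?_, ?_⟩)
      · rw [one_mul, ← Real.le_log_iff_exp_le (by linarith)]
        exact Nat.floor_le (Real.log_nonneg hx)
      · rw [← Real.exp_add, ← Real.log_le_iff_le_exp (by linarith), add_comm]
        exact (Nat.lt_floor_add_one _).le
  have hf1 : ∫⁻ x in annulus d 0 1, f x ∂ν ≤ ν (annulus d 0 1) := by
    calc ∫⁻ x in annulus d 0 1, f x ∂ν ≤ ∫⁻ _x in annulus d 0 1, 1 ∂ν := by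
          refine lintegral_mono fun x => ENNReal.ofReal_le_one.2 ?_
          exact Real.rpow_le_one_of_one_le_of_nonpos (by linarith [norm_nonneg x]) (by linarith)
      _ = ν (annulus d 0 1) := by simp
  have hf2 : ∀ n : ℕ, ∫⁻ x in annulus d (1 * (e n : ℝ)) (Real.exp 1 * e n), f x ∂ν
      ≤ ENNReal.ofReal (Real.exp (-γ * n) * (C * L (e n))) := by
    intro n
    calc ∫⁻ x in annulus d (1 * (e n : ℝ)) (Real.exp 1 * e n), f x ∂ν
        ≤ ∫⁻ _x in annulus d (1 * (e n : ℝ)) (Real.exp 1 * e n),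
            ENNReal.ofReal (Real.exp (-γ * n)) ∂ν := by
          refine setLIntegral_mono measurable_const fun x hx => ENNReal.ofReal_le_ofReal ?_
          have h1 : Real.exp n ≤ 1 + ‖x‖ := by
            have := hx.1
            rw [one_mul] at this
            exact this.trans (by linarith)
          calc (1 + ‖x‖) ^ (-γ) ≤ Real.exp n ^ (-γ) :=
                Real.rpow_le_rpow_of_nonpos (Real.exp_pos _) h1 (by linarith)
            _ = Real.exp (-γ * n) := by rw [← Real.exp_mul, mul_comm]
      _ = ENNReal.ofReal (Real.exp (-γ * n))
            * ν (annulus d (1 * (e n : ℝ)) (Real.exp 1 * e n)) := setLIntegral_const _ _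
      _ ≤ ENNReal.ofReal (Real.exp (-γ * n)) * ENNReal.ofReal (C * L (e n)) := by
          refine mul_le_mul_right (hC (e n) ?_) _
          exact Real.one_le_exp (Nat.cast_nonneg n)
      _ = _ := (ENNReal.ofReal_mul (Real.exp_pos _).le).symm
  calc ∫⁻ x, f x ∂ν = ∫⁻ x in Set.univ, f x ∂ν := by rw [Measure.restrict_univ]
    _ ≤ ∫⁻ x in annulus d 0 1 ∪ ⋃ n : ℕ, annulus d (1 * (e n : ℝ)) (Real.exp 1 * e n), f x ∂ν :=
        lintegral_mono_set hcover
    _ ≤ ∫⁻ x in annulus d 0 1, f x ∂ν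
        + ∫⁻ x in ⋃ n : ℕ, annulus d (1 * (e n : ℝ)) (Real.exp 1 * e n), f x ∂ν :=
        lintegral_union_le _ _ _
    _ ≤ ν (annulus d 0 1) + ∑' n : ℕ, ENNReal.ofReal (Real.exp (-γ * n) * (C * L (e n))) :=
        add_le_add hf1 ((lintegral_iUnion_le _ _).trans (ENNReal.tsum_le_tsum hf2))
    _ < ⊤ := by
        refine ENNReal.add_lt_top.2 ⟨annulus_lt_top _ _, ?_⟩
        rw [← ENNReal.ofReal_tsum_of_nonneg (fun n => ?_) hsum]
        · exact ENNReal.ofReal_lt_top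
        · exact mul_nonneg (Real.exp_pos _).le (mul_nonneg hC0 (hL.pos _).le)

end Invariant

end RandomDifference

end


theorem theorem2p1 (d : ℕ)
    (μ : Measure (RandomDifference.AffGroup d)) [IsProbabilityMeasure μ]
    (hH : RandomDifference.HypothesisH μ)
    (ν : Measure (RandomDifference.Euc d)) [IsLocallyFiniteMeasure ν]
    (hν_ne : ν ≠ 0) (hν_inv : RandomDifference.affConv μ ν = ν) :
    (∃ L : RandomDifference.PosReal → ℝ, RandomDifference.IsSlowlyVarying L ∧
      -- boundedness on every bounded compactly supported function
      (∀ φ : RandomDifference.Euc d → ℝ, Measurable φ → (∃ M : ℝ, ∀ x, |φ x| ≤ M) →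
        RandomDifference.HasPuncturedCompactSupport φ →
        ∃ C : ℝ, ∀ z : RandomDifference.PosReal, 1 ≤ z →
          |RandomDifference.normValue ν L z φ| ≤ C) ∧
      -- weak relative compactness of the family indexed by `z ≥ 1`
      (∀ zs : ℕ → RandomDifference.PosReal, (∀ n, 1 ≤ zs n) →
        ∃ (k : ℕ → ℕ) (η : Measure (RandomDifference.Euc d)), StrictMono k ∧
          RandomDifference.IsPuncturedRadon η ∧
          RandomDifference.NormTendsto ν L (zs ∘ k) η) ∧
      -- accumulation points are nonzero and invariant under `G(μ_A)`
      (∀ η : Measure (RandomDifference.Euc d), RandomDifference.IsAccumulationMeasure ν L η →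
        η ≠ 0 ∧ ∀ a ∈ RandomDifference.scaleGroup μ, RandomDifference.dilate a η = η)) ∧
    ∀ γ : ℝ, 0 < γ → Integrable (fun x : RandomDifference.Euc d => (1 + ‖x‖) ^ (-γ)) ν := by
  obtain ⟨φ₀, W, s₀, href⟩ := RandomDifference.exists_isReference hH hν_ne hν_inv
  obtain ⟨ℓ, hℓ, hmem⟩ := RandomDifference.exists_exp_mem_scaleGroup hH
  have hslow := href.isSlowlyVarying_normalizer hH hν_inv hℓ hmem
  have hdom := href.dominatesAnnuli hℓ
  refine ⟨⟨RandomDifference.normalizer ν φ₀ ℓ s₀, hslow, ?_, ?_, ?_⟩, ?_⟩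
  · rintro φ - ⟨M, hM⟩ hs
    obtain ⟨α, β, hα, -, h0⟩ := hs.exists_annulus
    obtain ⟨C, hC0, hC⟩ := hdom.normMeasure_le hslow.pos hα β
    refine ⟨M * C, fun z hz => ?_⟩
    rw [RandomDifference.normValue_eq_integral hslow.pos]
    exact RandomDifference.abs_integral_le_of_annulus hM h0 hC0 (hC z hz)
  · exact fun zs hzs => hdom.exists_subseq hslow.pos hzs
  · rintro η ⟨hη, zs, hzs, hlim⟩
    refine ⟨?_, fun a ha => RandomDifference.dilate_eq_of_mem_scaleGroup hH hν_inv hslow.pos hdom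
      hzs hη hlim ha⟩
    rintro rfl
    have := href.windowProfile_eq_one hℓ hzs hlim
    simp [RandomDifference.windowProfile, RandomDifference.scaleProfile] at this
  · exact fun γ hγ => RandomDifference.integrable_one_add_norm_rpow hslow hdom hγ
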